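/- Let $(M^{2m+1},\phi,\xi,\eta,g)$ be a Sasaki manifold, i.e. a smooth connected manifold with a smooth endomorphism field $\phi$, vector field $\xi$, 1-form $\eta$ and Riemannian metric $g$ such that $\phi^2=-I+\eta\otimes\xi$, $\eta(\xi)=1$, $g(\phi X,\phi Y)=g(X,Y)-\eta(X)\eta(Y)$, $\eta\wedge(d\eta)^m$ vanishes nowhere, $d\eta(X,Y)=g(X,\phi Y)$ and $[\phi,\phi](X,Y)+2\,d\eta(X,Y)\,\xi=0$, where $2\,d\eta(X,Y)=X\eta(Y)-Y\eta(X)-\eta([X,Y])$ and $[\phi,\phi]$ is the Nijenhuis tensor of $\phi$. Let $(N^{2n},J,g_N)$ be a connected Kähler manifold of real dimension $2n$, and let $\psi:M\to N$ be a surjective smooth submersion which is $(\phi,J)$-holomorphic, i.e. $d\psi\circ\phi=J\circ d\psi$. Put $\mathcal V=\ker d\psi$ and $\mathcal H=\mathcal V^{\perp}$, and let $J_{\mathcal H}=(d\psi|_{\mathcal H})^{-1}\circ J\circ d\psi$ be the almost complex structure induced on $\mathcal H$. Then: 1. $\psi$ is a pseudo-harmonic morphism, i.e. it is a harmonic map and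 is pseudo-horizontally weakly conformal: $g(J_{\mathcal H}X,J_{\mathcal H}Y)=g(X,Y)$ for all horizontal $X,Y$. 2. $\psi$ is pseudo-horizontally homothetic: in addition to the weak conformality in 1, $J_{\mathcal H}$ is parallel in horizontal directions, i.e. $(\nabla_X (J_{\mathcal H}Y))^{\mathcal H}=J_{\mathcal H}\big((\nabla_X Y)^{\mathcal H}\big)$ for all $X,Y\in\Gamma(\mathcal H)$, where $\nabla$ is the Levi-Civita connection of $g$ and $(\cdot)^{\mathcal H}$ is the orthogonal projection onto $\mathcal H$. 3. Every fiber $\psi^{-1}(y)$, $y\in N$, is a minimal submanifold of $M$, of dimension $2m+1-2n$. 4. For every (embedded) complex submanifold $K\subset N$ of complex dimension $k$, the preimage $\psi^{-1}(K)$ is a submanifold of $M$ of dimension $2k+2m+1-2n$ which is invariant ($\phi$ preserves its tangent spaces) and minimal. 5. If $m=n$, then $\mathcal H$ coincides with the contact distribution $\ker\eta$; if moreover $m\ge 1$, then $\mathcal H$ is not integrable. -/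

import Mathlib

open Set Filter Topology Manifold Bundle VectorField
open scoped ContDiff InnerProductSpace

noncomputable section

namespace SasakiPHH

section Defs

variable {E : Type*} [NormedAddCommGroup E] [NormedSpace ℝ E]
  {M : Type*} [TopologicalSpace M] [ChartedSpace E M]

/-- Vector fields on `M` (no regularity built in). -/
abbrev VF (E : Type*) [NormedAddCommGroup E] [NormedSpace ℝ E]
    (M : Type*) [TopologicalSpace M] [ChartedSpace E M] : Type _ :=
  ∀ x : M, TangentSpace 𝓘(ℝ, E) x

/-- Fields of endomorphisms of the tangent spaces, i.e. (1,1)-tensor fields. -/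
abbrev EndField (E : Type*) [NormedAddCommGroup E] [NormedSpace ℝ E]
    (M : Type*) [TopologicalSpace M] [ChartedSpace E M] : Type _ :=
  ∀ x : M, TangentSpace 𝓘(ℝ, E) x →L[ℝ] TangentSpace 𝓘(ℝ, E) x

/-- Fields of linear forms on the tangent spaces, i.e. 1-forms. -/
abbrev OneForm (E : Type*) [NormedAddCommGroup E] [NormedSpace ℝ E]
    (M : Type*) [TopologicalSpace M] [ChartedSpace E M] : Type _ :=
  ∀ x : M, TangentSpace 𝓘(ℝ, E) x →L[ℝ] ℝ

/-- Distributions: a subspace of each tangent space. -/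
abbrev Distribution (E : Type*) [NormedAddCommGroup E] [NormedSpace ℝ E]
    (M : Type*) [TopologicalSpace M] [ChartedSpace E M] : Type _ :=
  ∀ x : M, Submodule ℝ (TangentSpace 𝓘(ℝ, E) x)

instance instFiniteDimensionalTangentSpace [FiniteDimensional ℝ E] (x : M) :
    FiniteDimensional ℝ (TangentSpace 𝓘(ℝ, E) x) :=
  inferInstanceAs (FiniteDimensional ℝ E)

/-- The vector field `X` is smooth at (equivalently, near) the point `x`. -/
def SmoothVFAt [IsManifold 𝓘(ℝ, E) ∞ M] (X : VF E M) (x : M) : Prop :=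
  ContMDiffAt 𝓘(ℝ, E) 𝓘(ℝ, E).tangent ∞ (fun y ↦ (⟨y, X y⟩ : TangentBundle 𝓘(ℝ, E) M)) x

/-- The (1,1)-tensor field `A` is smooth. -/
def SmoothEnd [IsManifold 𝓘(ℝ, E) ∞ M] (A : EndField E M) : Prop :=
  ContMDiff 𝓘(ℝ, E) (𝓘(ℝ, E).prod 𝓘(ℝ, E →L[ℝ] E)) ∞
    (fun x ↦ TotalSpace.mk' (E →L[ℝ] E)
      (E := fun x : M ↦ TangentSpace 𝓘(ℝ, E) x →L[ℝ] TangentSpace 𝓘(ℝ, E) x) x (A x))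

/-- The 1-form `η` is smooth. -/
def SmoothForm [IsManifold 𝓘(ℝ, E) ∞ M] (η : OneForm E M) : Prop :=
  ContMDiff 𝓘(ℝ, E) (𝓘(ℝ, E).prod 𝓘(ℝ, E →L[ℝ] ℝ)) ∞
    (fun x ↦ TotalSpace.mk' (E →L[ℝ] ℝ)
      (E := fun x : M ↦ TangentSpace 𝓘(ℝ, E) x →L[ℝ] Bundle.Trivial M ℝ x) x (η x))

/-- A vector field extending the tangent vector `v`, with constant components in a local
trivialization of the tangent bundle near the base point of `v`. -/
def ext [IsManifold 𝓘(ℝ, E) ∞ M] {x : M} (v : TangentSpace 𝓘(ℝ, E) x) : VF E M :=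
  FiberBundle.extend E v

/-- The endomorphism field `A` applied to the vector field `X`. -/
def app (A : EndField E M) (X : VF E M) : VF E M := fun x ↦ A x (X x)

/-! ### Exterior derivative, Nijenhuis tensor, involutive distributions -/

/-- The exterior derivative of a 1-form, with the convention
`2 dη(X,Y) = X(η(Y)) - Y(η(X)) - η([X,Y])`. -/
def extDer (η : OneForm E M) (X Y : VF E M) (x : M) : ℝ :=
  (mvfderiv 𝓘(ℝ, E) (fun y ↦ η y (Y y)) x (X x)
    - mvfderiv 𝓘(ℝ, E) (fun y ↦ η y (X y)) x (Y x)
    - η x (mlieBracket 𝓘(ℝ, E) X Y x)) / 2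

/-- The Nijenhuis tensor `[φ,φ](X,Y) = φ²[X,Y] + [φX,φY] - φ[φX,Y] - φ[X,φY]`. -/
def nijenhuis (φ : EndField E M) (X Y : VF E M) (x : M) : TangentSpace 𝓘(ℝ, E) x :=
  φ x (φ x (mlieBracket 𝓘(ℝ, E) X Y x))
    + mlieBracket 𝓘(ℝ, E) (app φ X) (app φ Y) x
    - φ x (mlieBracket 𝓘(ℝ, E) (app φ X) Y x)
    - φ x (mlieBracket 𝓘(ℝ, E) X (app φ Y) x)

/-- A distribution is integrable when the brackets of its local smooth sections are again
sections of it. -/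
def IsIntegrable [IsManifold 𝓘(ℝ, E) ∞ M] (D : Distribution E M) : Prop :=
  ∀ (x : M) (X Y : VF E M), SmoothVFAt X x → SmoothVFAt Y x →
    (∀ᶠ y in 𝓝 x, X y ∈ D y) → (∀ᶠ y in 𝓝 x, Y y ∈ D y) →
    mlieBracket 𝓘(ℝ, E) X Y x ∈ D x

/-- The value of `η ∧ (dη)^m` on `2m+1` tangent vectors, up to a positive normalization constant
depending only on `m`: the full antisymmetrization of `η ⊗ dη ⊗ ⋯ ⊗ dη`. -/
def contactVolume [IsManifold 𝓘(ℝ, E) ∞ M] (m : ℕ) (η : OneForm E M) (x : M)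
    (v : Fin (2 * m + 1) → TangentSpace 𝓘(ℝ, E) x) : ℝ :=
  ∑ σ : Equiv.Perm (Fin (2 * m + 1)), ((Equiv.Perm.sign σ : ℤ) : ℝ) *
    (η x (v (σ ⟨0, by omega⟩)) *
      ∏ i : Fin m, extDer η (ext (v (σ ⟨2 * i + 1, by omega⟩)))
        (ext (v (σ ⟨2 * i + 2, by omega⟩))) x)

/-- `η` is a contact form on a `(2m+1)`-manifold: `η ∧ (dη)^m` vanishes nowhere. -/
def IsContactForm [IsManifold 𝓘(ℝ, E) ∞ M] (m : ℕ) (η : OneForm E M) : Prop :=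
  ∀ x : M, ∃ v : Fin (2 * m + 1) → TangentSpace 𝓘(ℝ, E) x, contactVolume m η x v ≠ 0

/-- The kernel of a 1-form; for a contact form this is the contact distribution. -/
def kerForm (η : OneForm E M) : Distribution E M :=
  fun x ↦ LinearMap.ker (η x : TangentSpace 𝓘(ℝ, E) x →ₗ[ℝ] ℝ)

/-- Almost contact structures `(φ, ξ, η)`. -/
structure IsAlmostContact [IsManifold 𝓘(ℝ, E) ∞ M]
    (φ : EndField E M) (ξ : VF E M) (η : OneForm E M) : Prop where
  smooth_phi : SmoothEnd φ
  smooth_xi : ∀ x, SmoothVFAt ξ x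
  smooth_eta : SmoothForm η
  phi_phi : ∀ x (v : TangentSpace 𝓘(ℝ, E) x), φ x (φ x v) = -v + η x v • ξ x
  eta_xi : ∀ x, η x (ξ x) = 1

section Riemannian

variable [FiniteDimensional ℝ E] [IsManifold 𝓘(ℝ, E) ∞ M]
  [RiemannianBundle (fun x : M ↦ TangentSpace 𝓘(ℝ, E) x)]

/-! ### Levi-Civita connection -/

/-- The Koszul expression `g(∇_v Y, w)`:
half of `V g(Y,W) + Y g(W,V) - W g(V,Y) + g([V,Y],W) - g([Y,W],V) + g([W,V],Y)`,
where `V`, `W` are local extensions of the tangent vectors `v`, `w`. -/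
def koszul {x : M} (v : TangentSpace 𝓘(ℝ, E) x) (Y : VF E M)
    (w : TangentSpace 𝓘(ℝ, E) x) : ℝ :=
  (mvfderiv 𝓘(ℝ, E) (fun y ↦ ⟪Y y, ext w y⟫_ℝ) x v
    + mvfderiv 𝓘(ℝ, E) (fun y ↦ ⟪ext w y, ext v y⟫_ℝ) x (Y x)
    - mvfderiv 𝓘(ℝ, E) (fun y ↦ ⟪ext v y, Y y⟫_ℝ) x w
    + ⟪mlieBracket 𝓘(ℝ, E) (ext v) Y x, w⟫_ℝ
    - ⟪mlieBracket 𝓘(ℝ, E) Y (ext w) x, v⟫_ℝ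
    + ⟪mlieBracket 𝓘(ℝ, E) (ext w) (ext v) x, Y x⟫_ℝ) / 2

/-- The Levi-Civita covariant derivative `∇_v Y` at `x` of a vector field `Y` smooth at `x`:
the tangent vector with `g(∇_v Y, w) = koszul v Y w` for all `w`. -/
def nabla {x : M} (v : TangentSpace 𝓘(ℝ, E) x) (Y : VF E M) : TangentSpace 𝓘(ℝ, E) x :=
  ∑ i, koszul v Y (stdOrthonormalBasis ℝ (TangentSpace 𝓘(ℝ, E) x) i) •
    stdOrthonormalBasis ℝ (TangentSpace 𝓘(ℝ, E) x) i

/-! ### Sasaki and Kähler structures -/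

/-- Almost contact metric structures `(φ, ξ, η, g)`. -/
structure IsAlmostContactMetric (φ : EndField E M) (ξ : VF E M) (η : OneForm E M) : Prop
    extends IsAlmostContact φ ξ η where
  compatible : ∀ x (u v : TangentSpace 𝓘(ℝ, E) x),
    ⟪φ x u, φ x v⟫_ℝ = ⟪u, v⟫_ℝ - η x u * η x v

/-- Contact metric structures on a `(2m+1)`-manifold: `η` is a contact form and
`dη(X,Y) = g(X, φY)`. -/
structure IsContactMetric (m : ℕ) (φ : EndField E M) (ξ : VF E M) (η : OneForm E M) : Prop
    extends IsAlmostContactMetric φ ξ η where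
  contact : IsContactForm m η
  associated : ∀ (x : M) (X Y : VF E M), SmoothVFAt X x → SmoothVFAt Y x →
    extDer η X Y x = ⟪X x, φ x (Y x)⟫_ℝ

/-- Sasaki structures: contact metric structures that are normal,
`[φ,φ](X,Y) + 2 dη(X,Y) ξ = 0`. -/
structure IsSasaki (m : ℕ) (φ : EndField E M) (ξ : VF E M) (η : OneForm E M) : Prop
    extends IsContactMetric m φ ξ η where
  normal : ∀ (x : M) (X Y : VF E M), SmoothVFAt X x → SmoothVFAt Y x →
    nijenhuis φ X Y x + (2 * extDer η X Y x) • ξ x = 0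

/-- Kähler structures `(J, g)`: `J² = -1`, `g` is `J`-invariant, `∇J = 0`. -/
structure IsKaehler (J : EndField E M) : Prop where
  smooth_J : SmoothEnd J
  J_J : ∀ x (v : TangentSpace 𝓘(ℝ, E) x), J x (J x v) = -v
  compatible : ∀ x (u v : TangentSpace 𝓘(ℝ, E) x), ⟪J x u, J x v⟫_ℝ = ⟪u, v⟫_ℝ
  parallel : ∀ (x : M) (v : TangentSpace 𝓘(ℝ, E) x) (Y : VF E M), SmoothVFAt Y x →
    nabla v (app J Y) = J x (nabla v Y)

/-! ### Submanifolds -/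

/-- `S` is a (smooth, embedded, not necessarily closed) submanifold of dimension `d`:
near each of its points it is the zero set of a submersion to `ℝ^c`, `d + c = dim M`. -/
def IsSubmanifold (S : Set M) (d : ℕ) : Prop :=
  ∀ x ∈ S, ∃ c : ℕ, d + c = Module.finrank ℝ E ∧
    ∃ U : Set M, IsOpen U ∧ x ∈ U ∧
    ∃ F : M → EuclideanSpace ℝ (Fin c),
      ContMDiffOn 𝓘(ℝ, E) 𝓘(ℝ, EuclideanSpace ℝ (Fin c)) ∞ F U ∧
      (∀ y ∈ U, Function.Surjective
        (mfderiv 𝓘(ℝ, E) 𝓘(ℝ, EuclideanSpace ℝ (Fin c)) F y)) ∧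
      ∀ y ∈ U, y ∈ S ↔ F y = 0

/-- The tangent space at `x` of the submanifold `S`: the tangent vectors of `M` annihilated by the
differentials of all smooth functions that vanish on `S` near `x`. -/
def tangentSub (S : Set M) (x : M) : Submodule ℝ (TangentSpace 𝓘(ℝ, E) x) :=
  ⨅ f : {f : M → ℝ // ContMDiffAt 𝓘(ℝ, E) 𝓘(ℝ, ℝ) ∞ f x ∧ ∀ᶠ y in 𝓝[S] x, f y = 0},
    LinearMap.ker (mvfderiv 𝓘(ℝ, E) f.1 x : TangentSpace 𝓘(ℝ, E) x →ₗ[ℝ] ℝ)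

/-- `S` is a minimal submanifold of dimension `d`: its mean curvature vanishes, i.e. for local
smooth vector fields `e₁, …, e_d` tangent to `S` along `S` and orthonormal at `x ∈ S`, the normal
component of `∑ ∇_{e_i} e_i`, the trace of the second fundamental form at `x`, is zero. -/
def IsMinimalSubmanifold (S : Set M) (d : ℕ) : Prop :=
  IsSubmanifold (E := E) S d ∧
  ∀ x ∈ S, ∀ e : Fin d → VF E M,
    (∀ i, SmoothVFAt (e i) x) →
    (∀ i, ∀ᶠ y in 𝓝[S] x, e i y ∈ tangentSub S y) →
    Orthonormal ℝ (fun i ↦ e i x) →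
    ((tangentSub (E := E) S x)ᗮ).starProjection (∑ i, nabla (e i x) (e i)) = 0

/-- `S` is invariant under the endomorphism field `A`: `A` preserves its tangent spaces. -/
def IsInvariantSub (A : EndField E M) (S : Set M) : Prop :=
  ∀ x ∈ S, ∀ v ∈ tangentSub (E := E) S x, A x v ∈ tangentSub (E := E) S x

/-- `K` is a complex submanifold, of complex dimension `k`, of the Kähler manifold `(M, J)`. -/
def IsComplexSubmanifold (J : EndField E M) (K : Set M) (k : ℕ) : Prop :=
  IsSubmanifold (E := E) K (2 * k) ∧ IsInvariantSub J K

/-! ### Maps between Riemannian manifolds -/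

variable {F : Type*} [NormedAddCommGroup F] [NormedSpace ℝ F] [FiniteDimensional ℝ F]
  {N : Type*} [TopologicalSpace N] [ChartedSpace F N] [IsManifold 𝓘(ℝ, F) ∞ N]

/-- The vertical distribution `ker dψ` of a map `ψ`. -/
def vertical (E F : Type*) [NormedAddCommGroup E] [NormedSpace ℝ E]
    [NormedAddCommGroup F] [NormedSpace ℝ F] {M N : Type*}
    [TopologicalSpace M] [ChartedSpace E M] [TopologicalSpace N] [ChartedSpace F N]
    (ψ : M → N) : Distribution E M :=
  fun x ↦ LinearMap.ker (mfderiv 𝓘(ℝ, E) 𝓘(ℝ, F) ψ x :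
    TangentSpace 𝓘(ℝ, E) x →ₗ[ℝ] TangentSpace 𝓘(ℝ, F) (ψ x))

/-- The horizontal distribution `(ker dψ)ᗮ` of a map `ψ`. -/
def horizontal (E F : Type*) [NormedAddCommGroup E] [NormedSpace ℝ E]
    [NormedAddCommGroup F] [NormedSpace ℝ F] {M N : Type*}
    [TopologicalSpace M] [ChartedSpace E M] [TopologicalSpace N] [ChartedSpace F N]
    [RiemannianBundle (fun x : M ↦ TangentSpace 𝓘(ℝ, E) x)]
    (ψ : M → N) : Distribution E M :=
  fun x ↦ (vertical E F ψ x)ᗮ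

/-- The structure induced by `J` on the horizontal bundle of a submersion `ψ`:
`J_H = (dψ|_H)⁻¹ ∘ J ∘ dψ`, a map from each tangent space to its horizontal subspace
(vanishing on vertical vectors). -/
def horJ (J : EndField F N) (ψ : M → N) (x : M) (v : TangentSpace 𝓘(ℝ, E) x) :
    TangentSpace 𝓘(ℝ, E) x :=
  Function.invFunOn (mfderiv 𝓘(ℝ, E) 𝓘(ℝ, F) ψ x)
    (horizontal E F ψ x : Set (TangentSpace 𝓘(ℝ, E) x))
    (J (ψ x) (mfderiv 𝓘(ℝ, E) 𝓘(ℝ, F) ψ x v))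

/-- Pseudo-horizontal (weak) conformality of a submersion `ψ` to an almost Hermitian manifold:
the induced almost complex structure on the horizontal bundle is compatible with the metric. -/
def IsPHWC (J : EndField F N) (ψ : M → N) : Prop :=
  ∀ (x : M), ∀ u ∈ horizontal E F ψ x, ∀ v ∈ horizontal E F ψ x,
    ⟪horJ J ψ x u, horJ J ψ x v⟫_ℝ = ⟪u, v⟫_ℝ

/-- Pseudo-horizontal homothety of a submersion `ψ`: `ψ` is pseudo-horizontally weakly conformal
and `J_H` is parallel in horizontal directions for the connection `∇^H` induced by the Levi-Civita
connection on the horizontal bundle `H` (the horizontal component of `∇`). -/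
def IsPHH (J : EndField F N) (ψ : M → N) : Prop :=
  IsPHWC (E := E) J ψ ∧
  ∀ (x : M), ∀ v ∈ horizontal E F ψ x, ∀ Y : VF E M, SmoothVFAt Y x →
    (∀ᶠ y in 𝓝 x, Y y ∈ horizontal E F ψ y) →
    (horizontal E F ψ x).starProjection (nabla v (fun y ↦ horJ J ψ y (Y y)))
      = horJ J ψ x ((horizontal E F ψ x).starProjection (nabla v Y))

variable [RiemannianBundle (fun y : N ↦ TangentSpace 𝓘(ℝ, F) y)]

/-- The pullback connection `∇^ψ_v s` on `ψ⁻¹(TN)`, for a section `s` of `ψ⁻¹(TN)`.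
In a local frame `(E_a)` of `TN` near `ψ x`, with `s = ∑ s_a (E_a ∘ ψ)`, it is
`∑ (v s_a) E_a + ∑ s_a(x) ∇_{dψ v} E_a`; here the frame is the one that is constant in the
preferred trivialization of `TN` at `ψ x`. -/
def pullbackNabla (ψ : M → N) (s : ∀ x : M, TangentSpace 𝓘(ℝ, F) (ψ x))
    {x : M} (v : TangentSpace 𝓘(ℝ, E) x) : TangentSpace 𝓘(ℝ, F) (ψ x) :=
  (trivializationAt F (TangentSpace 𝓘(ℝ, F) : N → Type _) (ψ x)).symmL ℝ (ψ x)
      (mvfderiv 𝓘(ℝ, E) (fun x' : M ↦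
        (trivializationAt F (TangentSpace 𝓘(ℝ, F) : N → Type _) (ψ x)).continuousLinearMapAt ℝ
          (ψ x') (s x')) x v)
    + nabla (mfderiv 𝓘(ℝ, E) 𝓘(ℝ, F) ψ x v) (ext (s x))

/-- The second fundamental form `(∇dψ)(u,v) = ∇^ψ_U (dψ V) - dψ(∇_U V)` of a map `ψ`. -/
def hessMap (ψ : M → N) {x : M} (u v : TangentSpace 𝓘(ℝ, E) x) : TangentSpace 𝓘(ℝ, F) (ψ x) :=
  pullbackNabla ψ (fun y ↦ mfderiv 𝓘(ℝ, E) 𝓘(ℝ, F) ψ y (ext v y)) u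
    - mfderiv 𝓘(ℝ, E) 𝓘(ℝ, F) ψ x (nabla u (ext v))

/-- The tension field `τ(ψ) = trace ∇dψ`. -/
def tension (E F : Type*) [NormedAddCommGroup E] [NormedSpace ℝ E]
    [NormedAddCommGroup F] [NormedSpace ℝ F] [FiniteDimensional ℝ E] [FiniteDimensional ℝ F]
    {M N : Type*} [TopologicalSpace M] [ChartedSpace E M] [TopologicalSpace N] [ChartedSpace F N]
    [IsManifold 𝓘(ℝ, E) ∞ M] [IsManifold 𝓘(ℝ, F) ∞ N]
    [RiemannianBundle (fun x : M ↦ TangentSpace 𝓘(ℝ, E) x)]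
    [RiemannianBundle (fun y : N ↦ TangentSpace 𝓘(ℝ, F) y)]
    (ψ : M → N) (x : M) : TangentSpace 𝓘(ℝ, F) (ψ x) :=
  ∑ i, hessMap ψ (stdOrthonormalBasis ℝ (TangentSpace 𝓘(ℝ, E) x) i)
    (stdOrthonormalBasis ℝ (TangentSpace 𝓘(ℝ, E) x) i)

/-- A smooth map is harmonic when its tension field vanishes. -/
def IsHarmonicMap (E F : Type*) [NormedAddCommGroup E] [NormedSpace ℝ E]
    [NormedAddCommGroup F] [NormedSpace ℝ F] [FiniteDimensional ℝ E] [FiniteDimensional ℝ F]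
    {M N : Type*} [TopologicalSpace M] [ChartedSpace E M] [TopologicalSpace N] [ChartedSpace F N]
    [IsManifold 𝓘(ℝ, E) ∞ M] [IsManifold 𝓘(ℝ, F) ∞ N]
    [RiemannianBundle (fun x : M ↦ TangentSpace 𝓘(ℝ, E) x)]
    [RiemannianBundle (fun y : N ↦ TangentSpace 𝓘(ℝ, F) y)]
    (ψ : M → N) : Prop :=
  ContMDiff 𝓘(ℝ, E) 𝓘(ℝ, F) ∞ ψ ∧ ∀ x, tension E F ψ x = 0

/-- Pseudo-harmonic morphisms (here: submersions): harmonic maps that are pseudo-horizontally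
weakly conformal. -/
def IsPseudoHarmonicMorphism (J : EndField F N) (ψ : M → N) : Prop :=
  IsHarmonicMap E F ψ ∧ IsPHWC (E := E) J ψ

/-- Smooth submersions `ψ : M → N` that are `(φ, J)`-holomorphic: `dψ ∘ φ = J ∘ dψ`. -/
structure IsHolomorphicSubmersion (φ : EndField E M) (J : EndField F N) (ψ : M → N) : Prop where
  smooth : ContMDiff 𝓘(ℝ, E) 𝓘(ℝ, F) ∞ ψ
  submersion : ∀ x, Function.Surjective (mfderiv 𝓘(ℝ, E) 𝓘(ℝ, F) ψ x)
  holomorphic : ∀ x (v : TangentSpace 𝓘(ℝ, E) x),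
    mfderiv 𝓘(ℝ, E) 𝓘(ℝ, F) ψ x (φ x v) = J (ψ x) (mfderiv 𝓘(ℝ, E) 𝓘(ℝ, F) ψ x v)

end Riemannian

end Defs

end SasakiPHH

end

open Set Filter Topology Manifold Bundle VectorField
open scoped ContDiff InnerProductSpace

noncomputable section

set_option linter.unusedSectionVars false

namespace SasakiPHH

/-! ### Derivatives of vector-valued functions on a manifold -/

section Calculus

variable {E : Type*} [NormedAddCommGroup E] [NormedSpace ℝ E]
  {M : Type*} [TopologicalSpace M] [ChartedSpace E M]
  {W : Type*} [NormedAddCommGroup W] [NormedSpace ℝ W]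
  {W' : Type*} [NormedAddCommGroup W'] [NormedSpace ℝ W']

/-! Everything rests on the Sasaki identity `(∇_v φ) u = g(v,u) ξ - η(u) v` (`IsSasaki.covEnd_phi`).
The field `ξ` is vertical, since `J (dψ ξ) = dψ (φ ξ) = 0` and `J` is invertible. By holomorphy `φ`
preserves `ker dψ`; being skew, it preserves `H` too. Hence `J_H` is the restriction of `φ` to `H`,
where `η` vanishes. Conformality is then compatibility of `φ` with `g`, and horizontal parallelism
is the Sasaki identity, whose only surviving term is a multiple of the vertical `ξ`.

Harmonicity and minimality are two instances of one trace computation, `trace_eq_zero`. Let `B` be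
symmetric bilinear with `B(u, φv) = J B(u,v) + η(v) T u`, where `J² = -1`, `T φ = J T` and `T ξ =
0`. Replacing an orthonormal basis by its `φ`-image changes the sign of the trace of `B`, yet it
also preserves the trace because `B(ξ,ξ) = 0`; so the trace is zero. For harmonicity `B = ∇dψ` and
`T = dψ`; the relation is the derivative of `dψ φ = J dψ`, with `∇J = 0` (`secondForm_phi`). For a
`φ`-invariant submanifold `S` tangent to `ξ`, `B` is the second fundamental form with values in `T_x
M / T_x S`, and `T = 0` because `(∇_v φ) u` is tangent to `S` (`IsSasaki.isMinimalSubmanifold`).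
Preimages of complex submanifolds are of this kind, and fibers are the preimages of points.

If `m = n`, the vertical space is a line, hence spanned by `ξ`, and `H = ker η`. Integrability would
force `dη(X, φX) = 0` on `ker η`, whereas `dη(X, φX) = -|X|²`.

All derivatives are computed in the preferred chart at the point, where the Levi-Civita connection
is `coordD` plus `christoffel` (`nabla_eq`). -/

lemma mvfderiv_congr {f g : M → W} {x : M} (h : f =ᶠ[𝓝 x] g) :
    mvfderiv 𝓘(ℝ, E) f x = mvfderiv 𝓘(ℝ, E) g x := by
  unfold mvfderiv
  rw [h.mfderiv_eq]
  have : f x = g x := h.eq_of_nhds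
  rfl

lemma mvfderiv_sum {ι : Type*} (s : Finset ι) {f : ι → M → W} {x : M}
    (h : ∀ i ∈ s, MDifferentiableAt 𝓘(ℝ, E) 𝓘(ℝ, W) (f i) x) :
    MDifferentiableAt 𝓘(ℝ, E) 𝓘(ℝ, W) (fun y ↦ ∑ i ∈ s, f i y) x ∧
    mvfderiv 𝓘(ℝ, E) (fun y ↦ ∑ i ∈ s, f i y) x = ∑ i ∈ s, mvfderiv 𝓘(ℝ, E) (f i) x := by
  classical
  induction s using Finset.induction_on with
  | empty => simpa using ⟨mdifferentiableAt_const, mvfderiv_const _⟩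
  | insert a s ha ih =>
    obtain ⟨h1, h2⟩ := ih fun i hi ↦ h i (Finset.mem_insert_of_mem hi)
    have h3 := h a (Finset.mem_insert_self a s)
    simp only [Finset.sum_insert ha]
    exact ⟨h3.add h1, by rw [mvfderiv_fun_add h3 h1, h2]⟩

lemma mvfderiv_clm_comp (A : W →L[ℝ] W') {f : M → W} {x : M}
    (h : MDifferentiableAt 𝓘(ℝ, E) 𝓘(ℝ, W) f x) :
    MDifferentiableAt 𝓘(ℝ, E) 𝓘(ℝ, W') (fun y ↦ A (f y)) x ∧
    ∀ v, mvfderiv 𝓘(ℝ, E) (fun y ↦ A (f y)) x v = A (mvfderiv 𝓘(ℝ, E) f x v) := by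
  have h1 : MDifferentiableAt 𝓘(ℝ, W) 𝓘(ℝ, W') A (f x) := A.differentiableAt.mdifferentiableAt
  refine ⟨h1.comp x h, fun v ↦ ?_⟩
  have := mfderiv_comp_apply x h1 h v
  rw [mfderiv_eq_fderiv, A.fderiv] at this
  exact this

end Calculus

/-! ### Components of vector fields in a trivialization -/

section Coordinates

variable {E : Type*} [NormedAddCommGroup E] [NormedSpace ℝ E]
  {M : Type*} [TopologicalSpace M] [ChartedSpace E M] [IsManifold 𝓘(ℝ, E) ∞ M]

/-- The preferred trivialization of the tangent bundle at `x`. -/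
abbrev triv (E : Type*) [NormedAddCommGroup E] [NormedSpace ℝ E]
    {M : Type*} [TopologicalSpace M] [ChartedSpace E M] [IsManifold 𝓘(ℝ, E) ∞ M] (x : M) :=
  trivializationAt E (TangentSpace 𝓘(ℝ, E) : M → Type _) x

/-- Vector components of `X` in the preferred trivialization at `x`. -/
def rep (x : M) (X : VF E M) (y : M) : E := (triv E x).continuousLinearMapAt ℝ y (X y)

/-- The coordinate derivative of `X` in direction `v`, in the preferred chart at `x`. -/
def coordD {x : M} (v : TangentSpace 𝓘(ℝ, E) x) (X : VF E M) : TangentSpace 𝓘(ℝ, E) x :=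
  (triv E x).symmL ℝ x (mvfderiv 𝓘(ℝ, E) (rep x X) x v)

lemma mem_triv (x : M) : x ∈ (triv E x).baseSet := FiberBundle.mem_baseSet_trivializationAt' x

lemma eventually_mem_triv (x : M) : ∀ᶠ y in 𝓝 x, y ∈ (triv E x).baseSet :=
  (triv E x).open_baseSet.mem_nhds (mem_triv x)

lemma continuousLinearMapAt_self (x : M) (v : TangentSpace 𝓘(ℝ, E) x) :
    (triv E x).continuousLinearMapAt ℝ x v = (triv E x ⟨x, v⟩).2 := by
  simp [Trivialization.continuousLinearMapAt_apply,
    Trivialization.coe_linearMapAt_of_mem _ (mem_triv x)]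

/-- In this form the linearity of the extension in `v` is visible. -/
lemma ext_eq {x y : M} (v : TangentSpace 𝓘(ℝ, E) x) (hy : y ∈ (triv E x).baseSet) :
    ext v y = (triv E x).symmL ℝ y ((triv E x).continuousLinearMapAt ℝ x v) := by
  rw [continuousLinearMapAt_self, Trivialization.symmL_apply _ hy]; rfl

@[simp] lemma ext_self {x : M} (v : TangentSpace 𝓘(ℝ, E) x) : ext v x = v :=
  FiberBundle.extend_apply_self ..

lemma ext_add {x y : M} (u v : TangentSpace 𝓘(ℝ, E) x) (hy : y ∈ (triv E x).baseSet) :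
    ext (u + v) y = ext u y + ext v y := by
  simp only [ext_eq _ hy, map_add]

lemma ext_smul {x y : M} (c : ℝ) (v : TangentSpace 𝓘(ℝ, E) x) (hy : y ∈ (triv E x).baseSet) :
    ext (c • v) y = c • ext v y := by
  simp only [ext_eq _ hy, map_smul]

lemma rep_ext {x y : M} (v : TangentSpace 𝓘(ℝ, E) x) (hy : y ∈ (triv E x).baseSet) :
    rep x (ext v) y = (triv E x).continuousLinearMapAt ℝ x v := by
  rw [rep, ext_eq _ hy, Trivialization.continuousLinearMapAt_symmL _ hy]

lemma smoothVFAt_ext {x y : M} (v : TangentSpace 𝓘(ℝ, E) x) (hy : y ∈ (triv E x).baseSet) :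
    SmoothVFAt (ext v) y := by
  refine (Trivialization.contMDiffAt_section_iff (IB := 𝓘(ℝ, E)) (triv E x) hy).2 ?_
  refine (contMDiffAt_const (c := (triv E x).continuousLinearMapAt ℝ x v)).congr_of_eventuallyEq ?_
  filter_upwards [(triv E x).open_baseSet.mem_nhds hy] with z hz
  have := rep_ext v hz
  rwa [rep, Trivialization.continuousLinearMapAt_apply,
    Trivialization.coe_linearMapAt_of_mem _ hz] at this

lemma rep_contMDiffAt {X : VF E M} {x y : M} (h : SmoothVFAt X y) (hy : y ∈ (triv E x).baseSet) :
    ContMDiffAt 𝓘(ℝ, E) 𝓘(ℝ, E) ∞ (rep x X) y := by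
  refine ((Trivialization.contMDiffAt_section_iff (IB := 𝓘(ℝ, E)) (triv E x) hy).1
    h).congr_of_eventuallyEq ?_
  filter_upwards [(triv E x).open_baseSet.mem_nhds hy] with z hz
  rw [rep, Trivialization.continuousLinearMapAt_apply,
    Trivialization.coe_linearMapAt_of_mem _ hz]

lemma symmL_rep {x y : M} (X : VF E M) (hy : y ∈ (triv E x).baseSet) :
    (triv E x).symmL ℝ y (rep x X y) = X y := by
  rw [rep, Trivialization.symmL_continuousLinearMapAt _ hy]

lemma ext_sum {x y : M} {ι : Type*} [Fintype ι] (c : ι → ℝ) (u : ι → TangentSpace 𝓘(ℝ, E) x)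
    (hy : y ∈ (triv E x).baseSet) : ext (∑ i, c i • u i) y = ∑ i, c i • ext (u i) y := by
  simp only [ext_eq _ hy, map_sum, map_smul]

lemma rep_mdiff {X : VF E M} {x : M} (h : SmoothVFAt X x) :
    MDifferentiableAt 𝓘(ℝ, E) 𝓘(ℝ, E) (rep x X) x :=
  (rep_contMDiffAt h (mem_triv x)).mdifferentiableAt (by simp)

/-! ### Local frames and the Leibniz rule -/

section Tensoriality

variable [FiniteDimensional ℝ E] {W : Type*} [NormedAddCommGroup W] [NormedSpace ℝ W]

/-- A fixed frame of the tangent bundle near `x`, constant in the preferred trivialization. -/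
def frame (x : M) (i : Fin (Module.finrank ℝ E)) : TangentSpace 𝓘(ℝ, E) x :=
  (triv E x).symmL ℝ x (Module.finBasis ℝ E i)

lemma eq_sum_frame {x y : M} (X : VF E M) (hy : y ∈ (triv E x).baseSet) :
    X y = ∑ i, (Module.finBasis ℝ E).repr (rep x X y) i • ext (frame x i) y := by
  conv_lhs => rw [← symmL_rep X hy, ← (Module.finBasis ℝ E).sum_repr (rep x X y)]
  simp only [map_sum, map_smul, frame, ext_eq _ hy,
    Trivialization.continuousLinearMapAt_symmL _ (mem_triv x)]

/-- The components of a smooth vector field. -/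
lemma comp_mdiff {X : VF E M} {x : M} (h : SmoothVFAt X x) (i) :
    MDifferentiableAt 𝓘(ℝ, E) 𝓘(ℝ, ℝ)
      (fun y ↦ (Module.finBasis ℝ E).repr (rep x X y) i) x := by
  exact (mvfderiv_clm_comp ((Module.finBasis ℝ E).coord i).toContinuousLinearMap (rep_mdiff h)).1

lemma comp_mvfderiv {X : VF E M} {x : M} (h : SmoothVFAt X x) (i)
    (v : TangentSpace 𝓘(ℝ, E) x) :
    mvfderiv 𝓘(ℝ, E) (fun y ↦ (Module.finBasis ℝ E).repr (rep x X y) i) x v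
      = (Module.finBasis ℝ E).repr (mvfderiv 𝓘(ℝ, E) (rep x X) x v) i := by
  exact (mvfderiv_clm_comp ((Module.finBasis ℝ E).coord i).toContinuousLinearMap (rep_mdiff h)).2 v

/-- Leibniz rule for fiberwise linear maps applied to vector fields: the derivative of `L(X)` is
the derivative of the coefficients of `L` plus `L` applied to the coordinate derivative of `X`. -/
lemma leibniz {x : M} (L : ∀ y : M, TangentSpace 𝓘(ℝ, E) y →ₗ[ℝ] W)
    (hL : ∀ u : TangentSpace 𝓘(ℝ, E) x,
      MDifferentiableAt 𝓘(ℝ, E) 𝓘(ℝ, W) (fun y ↦ L y (ext u y)) x)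
    {X : VF E M} (hX : SmoothVFAt X x) :
    MDifferentiableAt 𝓘(ℝ, E) 𝓘(ℝ, W) (fun y ↦ L y (X y)) x ∧
    ∀ v : TangentSpace 𝓘(ℝ, E) x, mvfderiv 𝓘(ℝ, E) (fun y ↦ L y (X y)) x v
      = mvfderiv 𝓘(ℝ, E) (fun y ↦ L y (ext (X x) y)) x v + L x (coordD v X) := by
  set c : Fin (Module.finrank ℝ E) → M → ℝ :=
    fun i y ↦ (Module.finBasis ℝ E).repr (rep x X y) i with hc
  have e1 : (fun y ↦ L y (X y)) =ᶠ[𝓝 x] fun y ↦ ∑ i, c i y • L y (ext (frame x i) y) := by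
    filter_upwards [eventually_mem_triv (E := E) x] with y hy
    rw [eq_sum_frame X hy]; simp [hc, map_sum]
  have e2 : (fun y ↦ L y (ext (X x) y)) =ᶠ[𝓝 x] fun y ↦ ∑ i, c i x • L y (ext (frame x i) y) := by
    filter_upwards [eventually_mem_triv (E := E) x] with y hy
    conv_lhs => rw [eq_sum_frame X (mem_triv x)]
    simp only [ext_self]
    rw [ext_sum _ _ hy]; simp [hc, map_sum]
  have hc' : ∀ i, MDifferentiableAt 𝓘(ℝ, E) 𝓘(ℝ, ℝ) (c i) x := fun i ↦ comp_mdiff hX i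
  obtain ⟨d1, s1⟩ := mvfderiv_sum (E := E) (M := M) (x := x) Finset.univ
    (f := fun i y ↦ c i y • L y (ext (frame x i) y)) (fun i _ ↦ (hc' i).smul (hL _))
  obtain ⟨d2, s2⟩ := mvfderiv_sum (E := E) (M := M) (x := x) Finset.univ
    (f := fun i y ↦ c i x • L y (ext (frame x i) y))
    (fun i _ ↦ (mdifferentiableAt_const).smul (hL _))
  refine ⟨d1.congr_of_eventuallyEq e1, fun v ↦ ?_⟩
  rw [mvfderiv_congr e1, mvfderiv_congr e2, s1, s2]
  have h3 : coordD v X = ∑ i, mvfderiv 𝓘(ℝ, E) (c i) x v • frame x i := by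
    rw [coordD, ← (Module.finBasis ℝ E).sum_repr (mvfderiv 𝓘(ℝ, E) (rep x X) x v)]
    simp only [map_sum, map_smul, hc, comp_mvfderiv hX, frame]
  rw [h3]
  simp only [map_sum, map_smul, sum_apply, ← Finset.sum_add_distrib]
  refine Finset.sum_congr rfl fun i _ ↦ ?_
  rw [mvfderiv_fun_smul (hc' i) (hL _), mvfderiv_fun_smul mdifferentiableAt_const (hL _),
    mvfderiv_const]
  simp

end Tensoriality

end Coordinates

/-! ### Coordinate fields, second derivatives and Lie brackets in a chart -/

section Chart

variable {E : Type*} [NormedAddCommGroup E] [NormedSpace ℝ E]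
  {M : Type*} [TopologicalSpace M] [ChartedSpace E M] [IsManifold 𝓘(ℝ, E) ∞ M]
  {W : Type*} [NormedAddCommGroup W] [NormedSpace ℝ W]

lemma coordD_ext {x : M} (u v : TangentSpace 𝓘(ℝ, E) x) : coordD v (ext u) = 0 := by
  have : rep x (ext u) =ᶠ[𝓝 x] fun _ ↦ (triv E x).continuousLinearMapAt ℝ x u := by
    filter_upwards [eventually_mem_triv (E := E) x] with y hy using rep_ext u hy
  rw [coordD, mvfderiv_congr this, mvfderiv_const]
  simp

lemma coordD_congr {X Y : VF E M} {x : M} (v : TangentSpace 𝓘(ℝ, E) x) (h : X =ᶠ[𝓝 x] Y) :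
    coordD v X = coordD v Y := by
  have : rep x X =ᶠ[𝓝 x] rep x Y := by
    filter_upwards [h] with y hy
    rw [rep, rep, hy]
  rw [coordD, coordD, mvfderiv_congr this]

lemma mem_triv_iff {x y : M} : y ∈ (triv E x).baseSet ↔ y ∈ (chartAt E x).source := by
  simp

/-- Derivatives along the coordinate fields at `x` are derivatives in the chart at `x`. -/
lemma mvfderiv_ext {x y : M} {f : M → W} (hy : y ∈ (triv E x).baseSet)
    (hf : MDifferentiableAt 𝓘(ℝ, E) 𝓘(ℝ, W) f y) (u : TangentSpace 𝓘(ℝ, E) x) :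
    mvfderiv 𝓘(ℝ, E) f y (ext u y) =
      fderiv ℝ (f ∘ (extChartAt 𝓘(ℝ, E) x).symm) (extChartAt 𝓘(ℝ, E) x y)
        ((triv E x).continuousLinearMapAt ℝ x u) := by
  have hy' := mem_triv_iff.1 hy
  have hy2 : y ∈ (extChartAt 𝓘(ℝ, E) x).source := by rwa [extChartAt_source]
  have h3 : (extChartAt 𝓘(ℝ, E) x).symm (extChartAt 𝓘(ℝ, E) x y) = y :=
    (extChartAt 𝓘(ℝ, E) x).left_inv hy2
  have h4 : MDifferentiableAt 𝓘(ℝ, E) 𝓘(ℝ, E) (extChartAt 𝓘(ℝ, E) x).symm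
      (extChartAt 𝓘(ℝ, E) x y) := by
    have := mdifferentiableWithinAt_extChartAt_symm (I := 𝓘(ℝ, E))
      ((extChartAt 𝓘(ℝ, E) x).map_source hy2)
    simpa [mdifferentiableWithinAt_univ] using this
  have h5 := mfderiv_comp_apply_of_eq (I := 𝓘(ℝ, E)) (extChartAt 𝓘(ℝ, E) x y) hf h4 h3
    ((triv E x).continuousLinearMapAt ℝ x u)
  have h6 : ext u y = mfderiv 𝓘(ℝ, E) 𝓘(ℝ, E) (extChartAt 𝓘(ℝ, E) x).symm
      (extChartAt 𝓘(ℝ, E) x y) ((triv E x).continuousLinearMapAt ℝ x u) := by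
    have h7 := TangentBundle.symmL_trivializationAt (I := 𝓘(ℝ, E)) hy'
    rw [ext_eq _ hy]
    rw [modelWithCornersSelf_coe, range_id, mfderivWithin_univ] at h7
    exact congrArg (fun A ↦ A ((triv E x).continuousLinearMapAt ℝ x u)) h7
  rw [h6]
  rw [mfderiv_eq_fderiv] at h5
  exact h5.symm

lemma contMDiffAt_eventually_mdiff {x : M} {f : M → W}
    (hf : ContMDiffAt 𝓘(ℝ, E) 𝓘(ℝ, W) ∞ f x) :
    ∀ᶠ y in 𝓝 x, MDifferentiableAt 𝓘(ℝ, E) 𝓘(ℝ, W) f y := by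
  have h1 : ContMDiffAt 𝓘(ℝ, E) 𝓘(ℝ, W) 1 f x := hf.of_le (by simp)
  have := (contMDiffAt_iff_contMDiffAt_nhds (by simp)).1 h1
  exact this.mono fun y hy ↦ hy.mdifferentiableAt (by simp)

lemma contDiffAt_comp_extChartAt_symm {x : M} {f : M → W}
    (hf : ContMDiffAt 𝓘(ℝ, E) 𝓘(ℝ, W) ∞ f x) :
    ContDiffAt ℝ ∞ (f ∘ (extChartAt 𝓘(ℝ, E) x).symm) (extChartAt 𝓘(ℝ, E) x x) := by
  have := (contMDiffAt_iff.1 hf).2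
  rw [modelWithCornersSelf_coe, range_id, contDiffWithinAt_univ, extChartAt_model_space_eq_id] at this
  exact this

lemma mvfderiv_ext_eventuallyEq {x : M} {f : M → W} (hf : ContMDiffAt 𝓘(ℝ, E) 𝓘(ℝ, W) ∞ f x)
    (u : TangentSpace 𝓘(ℝ, E) x) :
    (fun y ↦ mvfderiv 𝓘(ℝ, E) f y (ext u y)) =ᶠ[𝓝 x]
      (fun z ↦ fderiv ℝ (f ∘ (extChartAt 𝓘(ℝ, E) x).symm) z
        ((triv E x).continuousLinearMapAt ℝ x u)) ∘ extChartAt 𝓘(ℝ, E) x := by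
  filter_upwards [eventually_mem_triv (E := E) x, contMDiffAt_eventually_mdiff hf] with y hy h
  exact mvfderiv_ext hy h u

lemma contDiffAt_fderiv_apply {F : E → W} {z : E} (h : ContDiffAt ℝ ∞ F z) (u : E) :
    ContDiffAt ℝ ∞ (fun z ↦ fderiv ℝ F z u) z :=
  (h.fderiv_right (m := ∞) (by simp)).clm_apply contDiffAt_const

/-- Coordinate derivatives of a smooth function are smooth. -/
lemma contMDiffAt_mvfderiv_ext {x : M} {f : M → W} (hf : ContMDiffAt 𝓘(ℝ, E) 𝓘(ℝ, W) ∞ f x)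
    (u : TangentSpace 𝓘(ℝ, E) x) :
    ContMDiffAt 𝓘(ℝ, E) 𝓘(ℝ, W) ∞ (fun y ↦ mvfderiv 𝓘(ℝ, E) f y (ext u y)) x :=
  ((contDiffAt_fderiv_apply (contDiffAt_comp_extChartAt_symm hf) _).contMDiffAt.comp x
    contMDiffAt_extChartAt).congr_of_eventuallyEq (mvfderiv_ext_eventuallyEq hf u)

/-- Reduces iterated coordinate derivatives to a second Fréchet derivative, to which Schwarz's
theorem applies. -/
lemma mvfderiv_mvfderiv_ext {x : M} {f : M → W} (hf : ContMDiffAt 𝓘(ℝ, E) 𝓘(ℝ, W) ∞ f x)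
    (u v : TangentSpace 𝓘(ℝ, E) x) :
    mvfderiv 𝓘(ℝ, E) (fun y ↦ mvfderiv 𝓘(ℝ, E) f y (ext u y)) x v =
      fderiv ℝ (fderiv ℝ (f ∘ (extChartAt 𝓘(ℝ, E) x).symm)) (extChartAt 𝓘(ℝ, E) x x)
        ((triv E x).continuousLinearMapAt ℝ x v) ((triv E x).continuousLinearMapAt ℝ x u) := by
  have h1 := contMDiffAt_mvfderiv_ext hf u
  have h2 := mvfderiv_ext (mem_triv x) (h1.mdifferentiableAt (by simp)) v
  rw [ext_self] at h2
  rw [h2]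
  have hF := contDiffAt_comp_extChartAt_symm hf
  have h3 : (fun y ↦ mvfderiv 𝓘(ℝ, E) f y (ext u y)) ∘ (extChartAt 𝓘(ℝ, E) x).symm
      =ᶠ[𝓝 (extChartAt 𝓘(ℝ, E) x x)]
      (fun z ↦ fderiv ℝ (f ∘ (extChartAt 𝓘(ℝ, E) x).symm) z
        ((triv E x).continuousLinearMapAt ℝ x u)) := by
    have h4 : Tendsto (extChartAt 𝓘(ℝ, E) x).symm (𝓝 (extChartAt 𝓘(ℝ, E) x x)) (𝓝 x) := by
      have := continuousAt_extChartAt_symm (I := 𝓘(ℝ, E)) x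
      rwa [ContinuousAt, extChartAt_to_inv] at this
    filter_upwards [h4.eventually (mvfderiv_ext_eventuallyEq hf u),
      extChartAt_target_mem_nhds (I := 𝓘(ℝ, E)) x] with z hz hz'
    simp only [Function.comp_apply] at hz ⊢
    rw [hz, (extChartAt 𝓘(ℝ, E) x).right_inv hz']
  rw [h3.fderiv_eq]
  have h5 : DifferentiableAt ℝ (fderiv ℝ (f ∘ (extChartAt 𝓘(ℝ, E) x).symm))
      (extChartAt 𝓘(ℝ, E) x x) :=
    (hF.fderiv_right (m := 1) (by norm_cast)).differentiableAt (by simp)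
  rw [fderiv_clm_apply h5 (differentiableAt_const _)]
  simp [-extChartAt]

/-- Coordinate derivatives commute. -/
lemma mvfderiv_mvfderiv_ext_comm {x : M} {f : M → W} (hf : ContMDiffAt 𝓘(ℝ, E) 𝓘(ℝ, W) ∞ f x)
    (u v : TangentSpace 𝓘(ℝ, E) x) :
    mvfderiv 𝓘(ℝ, E) (fun y ↦ mvfderiv 𝓘(ℝ, E) f y (ext u y)) x v =
      mvfderiv 𝓘(ℝ, E) (fun y ↦ mvfderiv 𝓘(ℝ, E) f y (ext v y)) x u := by
  rw [mvfderiv_mvfderiv_ext hf, mvfderiv_mvfderiv_ext hf]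
  exact (contDiffAt_comp_extChartAt_symm hf).isSymmSndFDerivAt (by simp; norm_cast) _ _

/-- The preferred trivialization is the differential of the chart, so the fields pulled back to the
model space are their component functions, and the bracket is the usual one of these. -/
lemma mlieBracket_eq [CompleteSpace E] {x : M} {X Y : VF E M} (hX : SmoothVFAt X x)
    (hY : SmoothVFAt Y x) :
    mlieBracket 𝓘(ℝ, E) X Y x = coordD (X x) Y - coordD (Y x) X := by
  have key : ∀ Z : VF E M, SmoothVFAt Z x →
      mpullbackWithin 𝓘(ℝ, E) 𝓘(ℝ, E) (extChartAt 𝓘(ℝ, E) x).symm Z (range 𝓘(ℝ, E))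
        =ᶠ[𝓝 (extChartAt 𝓘(ℝ, E) x x)] rep x Z ∘ (extChartAt 𝓘(ℝ, E) x).symm := by
    intro Z hZ
    filter_upwards [extChartAt_target_mem_nhds (I := 𝓘(ℝ, E)) x] with z hz
    have hs := (extChartAt 𝓘(ℝ, E) x).map_target hz
    rw [extChartAt_source] at hs
    have h1 := TangentBundle.continuousLinearMapAt_trivializationAt (I := 𝓘(ℝ, E)) hs
    have h2 := ContinuousLinearMap.inverse_eq
      (mfderivWithin_extChartAt_symm_comp_mfderiv_extChartAt hz)
      (mfderiv_extChartAt_comp_mfderivWithin_extChartAt_symm (I := 𝓘(ℝ, E)) hz)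
    exact congrArg (fun A ↦ A (Z ((extChartAt 𝓘(ℝ, E) x).symm z))) (h2.trans h1.symm)
  have key2 : ∀ (Z : VF E M) (_ : SmoothVFAt Z x) (v : TangentSpace 𝓘(ℝ, E) x),
      coordD v Z = (triv E x).symmL ℝ x (fderiv ℝ (rep x Z ∘ (extChartAt 𝓘(ℝ, E) x).symm)
        (extChartAt 𝓘(ℝ, E) x x) ((triv E x).continuousLinearMapAt ℝ x v)) := by
    intro Z hZ v
    have := mvfderiv_ext (mem_triv x) (rep_mdiff hZ) v
    rw [ext_self] at this
    rw [coordD, this]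
  set b : E := lieBracket ℝ (rep x X ∘ (extChartAt 𝓘(ℝ, E) x).symm)
    (rep x Y ∘ (extChartAt 𝓘(ℝ, E) x).symm) (extChartAt 𝓘(ℝ, E) x x) with hb
  have h3 : mlieBracket 𝓘(ℝ, E) X Y x =
      (mfderiv 𝓘(ℝ, E) 𝓘(ℝ, E) (extChartAt 𝓘(ℝ, E) x) x).inverse b := by
    rw [hb, ← (key X hX).lieBracket_vectorField_eq (key Y hY)]
    rw [mlieBracket, mlieBracketWithin_apply, preimage_univ, univ_inter, modelWithCornersSelf_coe,
      range_id]
    exact congrArg (mfderiv 𝓘(ℝ, E) 𝓘(ℝ, E) (extChartAt 𝓘(ℝ, E) x) x).inverse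
      (congrFun (lieBracketWithin_univ (E := E)) _)
  have h4 : (mfderiv 𝓘(ℝ, E) 𝓘(ℝ, E) (extChartAt 𝓘(ℝ, E) x) x).inverse =
      (triv E x).symmL ℝ x := by
    have hs := mem_extChartAt_source (I := 𝓘(ℝ, E)) x
    exact (ContinuousLinearMap.inverse_eq
      (mfderiv_extChartAt_comp_mfderivWithin_extChartAt_symm' hs)
      (mfderivWithin_extChartAt_symm_comp_mfderiv_extChartAt' hs)).trans
      (TangentBundle.symmL_trivializationAt (I := 𝓘(ℝ, E)) (mem_chart_source E x)).symm
  rw [key2 Y hY, key2 X hX, ← map_sub, h3]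
  refine (congrArg (fun A ↦ A b) h4).trans ?_
  rw [hb, lieBracket]
  have h5 : ∀ Z : VF E M, rep x Z ((extChartAt 𝓘(ℝ, E) x).symm (extChartAt 𝓘(ℝ, E) x x)) =
      (triv E x).continuousLinearMapAt ℝ x (Z x) := fun Z ↦ by rw [extChartAt_to_inv, rep]
  simp only [Function.comp_apply, h5]
  rfl

/-- The constant vector field on a vector space. -/
def constField (c : E) : VF E E := fun _ ↦ c

/-- Coordinate fields commute. -/
lemma mlieBracket_ext [CompleteSpace E] {x y : M} (u v : TangentSpace 𝓘(ℝ, E) x)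
    (hy : y ∈ (triv E x).baseSet) :
    mlieBracket 𝓘(ℝ, E) (ext u) (ext v) y = 0 := by
  have hs := mem_triv_iff.1 hy
  have hs2 : y ∈ (extChartAt 𝓘(ℝ, E) x).source := by rwa [extChartAt_source]
  -- Coordinate fields are pullbacks of constant fields under the chart, and the bracket is natural
  -- under pullback. The statement is needed at all `y` near `x`, since `dη` of coordinate fields
  -- will be differentiated.
  have key : ∀ w : TangentSpace 𝓘(ℝ, E) x, ext w =ᶠ[𝓝 y]
      mpullback 𝓘(ℝ, E) 𝓘(ℝ, E) (extChartAt 𝓘(ℝ, E) x)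
        (constField ((triv E x).continuousLinearMapAt ℝ x w)) := by
    intro w
    filter_upwards [(triv E x).open_baseSet.mem_nhds hy] with z hz
    have hs := mem_triv_iff.1 hz
    have hs2 : z ∈ (extChartAt 𝓘(ℝ, E) x).source := by rwa [extChartAt_source]
    have h1 := TangentBundle.symmL_trivializationAt (I := 𝓘(ℝ, E)) hs
    have h2 := ContinuousLinearMap.inverse_eq
      (mfderiv_extChartAt_comp_mfderivWithin_extChartAt_symm' hs2)
      (mfderivWithin_extChartAt_symm_comp_mfderiv_extChartAt' (I := 𝓘(ℝ, E)) hs2)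
    exact (ext_eq _ hz).trans (congrArg (fun A ↦ A ((triv E x).continuousLinearMapAt ℝ x w))
      (h1.trans h2.symm))
  rw [(key u).mlieBracket_vectorField_eq (key v)]
  have hc : ∀ c : E, MDifferentiableAt 𝓘(ℝ, E) 𝓘(ℝ, E).tangent
      (fun z ↦ (⟨z, constField c z⟩ : TangentBundle 𝓘(ℝ, E) E)) (extChartAt 𝓘(ℝ, E) x y) := by
    intro c
    exact ((contMDiffAt_vectorSpace_iff_contDiffAt (n := 1)).2 contDiffAt_const).mdifferentiableAt
      (by simp)
  have : IsManifold 𝓘(ℝ, E) (minSmoothness ℝ 2) M := IsManifold.of_le (n := ∞) (by simp; norm_cast)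
  have := mpullback_mlieBracket (n := ∞) (hc ((triv E x).continuousLinearMapAt ℝ x u))
    (hc ((triv E x).continuousLinearMapAt ℝ x v)) (contMDiffAt_extChartAt' hs) (by simp; norm_cast)
  refine this.symm.trans ?_
  have h0 : lieBracket ℝ (constField ((triv E x).continuousLinearMapAt ℝ x u))
    (constField ((triv E x).continuousLinearMapAt ℝ x v)) (extChartAt 𝓘(ℝ, E) x y) = 0 := by
    unfold constField lieBracket
    simp
  have h1 : mlieBracket 𝓘(ℝ, E) (constField ((triv E x).continuousLinearMapAt ℝ x u))
    (constField ((triv E x).continuousLinearMapAt ℝ x v)) (extChartAt 𝓘(ℝ, E) x y) = 0 := by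
    rw [← mlieBracketWithin_univ, mlieBracketWithin_eq_lieBracketWithin]
    exact (congrFun (lieBracketWithin_univ (E := E)) _).trans h0
  rw [mpullback_apply, h1, map_zero]

end Chart

/-! ### The Levi-Civita connection and its Christoffel symbols -/

section LeviCivita

variable {E : Type*} [NormedAddCommGroup E] [NormedSpace ℝ E] [FiniteDimensional ℝ E]
  {M : Type*} [TopologicalSpace M] [ChartedSpace E M] [IsManifold 𝓘(ℝ, E) ∞ M]
  [RiemannianBundle (fun x : M ↦ TangentSpace 𝓘(ℝ, E) x)]
  [IsContMDiffRiemannianBundle 𝓘(ℝ, E) ∞ E (fun x : M ↦ TangentSpace 𝓘(ℝ, E) x)]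

lemma smooth_inner {x : M} {X Y : VF E M} (hX : SmoothVFAt X x) (hY : SmoothVFAt Y x) :
    ContMDiffAt 𝓘(ℝ, E) 𝓘(ℝ, ℝ) ∞ (fun y ↦ ⟪X y, Y y⟫_ℝ) x :=
  ContMDiffAt.inner_bundle (F := E) (E := fun x : M ↦ TangentSpace 𝓘(ℝ, E) x)
    (IB := 𝓘(ℝ, E)) hX hY

lemma mdiff_inner {x : M} {X Y : VF E M} (hX : SmoothVFAt X x) (hY : SmoothVFAt Y x) :
    MDifferentiableAt 𝓘(ℝ, E) 𝓘(ℝ, ℝ) (fun y ↦ ⟪X y, Y y⟫_ℝ) x :=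
  (smooth_inner hX hY).mdifferentiableAt (by simp)

/-- Derivative of the coefficients of the metric. -/
def metricD {x : M} (v a b : TangentSpace 𝓘(ℝ, E) x) : ℝ :=
  mvfderiv 𝓘(ℝ, E) (fun y ↦ ⟪ext a y, ext b y⟫_ℝ) x v

lemma smooth_ext {x : M} (v : TangentSpace 𝓘(ℝ, E) x) : SmoothVFAt (ext v) x :=
  smoothVFAt_ext v (mem_triv x)

lemma metricD_comm {x : M} (v a b : TangentSpace 𝓘(ℝ, E) x) : metricD v a b = metricD v b a := by
  simp only [metricD, real_inner_comm]

lemma mvfderiv_inner {x : M} {X Y : VF E M} (hX : SmoothVFAt X x) (hY : SmoothVFAt Y x)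
    (v : TangentSpace 𝓘(ℝ, E) x) :
    mvfderiv 𝓘(ℝ, E) (fun y ↦ ⟪X y, Y y⟫_ℝ) x v =
      metricD v (X x) (Y x) + ⟪coordD v X, Y x⟫_ℝ + ⟪X x, coordD v Y⟫_ℝ := by
  have h1 := (leibniz (x := x) (fun y ↦ (innerₗ (TangentSpace 𝓘(ℝ, E) y)) (X y))
    (fun u ↦ mdiff_inner hX (smooth_ext u)) hY).2 v
  have h2 := (leibniz (x := x) (fun y ↦ (innerₗ (TangentSpace 𝓘(ℝ, E) y)) (ext (Y x) y))
    (fun u ↦ mdiff_inner (smooth_ext _) (smooth_ext u)) hX).2 v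
  simp only [innerₗ_apply_apply, ext_self] at h1 h2
  rw [h1, metricD_comm, metricD, real_inner_comm (Y x), ← h2]
  simp only [real_inner_comm]

lemma metricD_add {x : M} (v a a' b : TangentSpace 𝓘(ℝ, E) x) :
    metricD v (a + a') b = metricD v a b + metricD v a' b := by
  have : (fun y ↦ ⟪ext (a + a') y, ext b y⟫_ℝ) =ᶠ[𝓝 x]
      fun y ↦ ⟪ext a y, ext b y⟫_ℝ + ⟪ext a' y, ext b y⟫_ℝ := by
    filter_upwards [eventually_mem_triv (E := E) x] with y hy
    rw [ext_add _ _ hy, inner_add_left]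
  rw [metricD, mvfderiv_congr this, mvfderiv_fun_add (mdiff_inner (smooth_ext _) (smooth_ext _))
    (mdiff_inner (smooth_ext _) (smooth_ext _))]
  rfl

lemma metricD_smul {x : M} (c : ℝ) (v a b : TangentSpace 𝓘(ℝ, E) x) :
    metricD v (c • a) b = c * metricD v a b := by
  have : (fun y ↦ ⟪ext (c • a) y, ext b y⟫_ℝ) =ᶠ[𝓝 x]
      fun y ↦ c • ⟪ext a y, ext b y⟫_ℝ := by
    filter_upwards [eventually_mem_triv (E := E) x] with y hy
    rw [ext_smul _ _ hy, real_inner_smul_left]; rfl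
  rw [metricD, mvfderiv_congr this, mvfderiv_fun_smul mdifferentiableAt_const
    (mdiff_inner (smooth_ext _) (smooth_ext _)), mvfderiv_const]
  simp [metricD]

lemma metricD_add_right {x : M} (v a b b' : TangentSpace 𝓘(ℝ, E) x) :
    metricD v a (b + b') = metricD v a b + metricD v a b' := by
  rw [metricD_comm, metricD_add, metricD_comm v b, metricD_comm v b']

lemma metricD_smul_right {x : M} (c : ℝ) (v a b : TangentSpace 𝓘(ℝ, E) x) :
    metricD v a (c • b) = c * metricD v a b := by
  rw [metricD_comm, metricD_smul, metricD_comm v b]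

lemma metricD_add_dir {x : M} (v v' a b : TangentSpace 𝓘(ℝ, E) x) :
    metricD (v + v') a b = metricD v a b + metricD v' a b := map_add _ _ _

lemma metricD_smul_dir {x : M} (c : ℝ) (v a b : TangentSpace 𝓘(ℝ, E) x) :
    metricD (c • v) a b = c * metricD v a b := map_smul _ _ _

/-- The extensions of `v` and `w` have vanishing coordinate derivatives, and the derivatives of `Y`
along `w` cancel between the metric and bracket terms. What is left is linear in `w`. -/
lemma koszul_eq {x : M} {Y : VF E M} (hY : SmoothVFAt Y x) (v w : TangentSpace 𝓘(ℝ, E) x) :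
    koszul v Y w = ⟪coordD v Y, w⟫_ℝ +
      (metricD v (Y x) w + metricD (Y x) w v - metricD w v (Y x)) / 2 := by
  rw [koszul, mvfderiv_inner hY (smooth_ext w), mvfderiv_inner (smooth_ext w) (smooth_ext v),
    mvfderiv_inner (smooth_ext v) hY, mlieBracket_eq (smooth_ext v) hY,
    mlieBracket_eq hY (smooth_ext w), mlieBracket_eq (smooth_ext w) (smooth_ext v)]
  simp only [coordD_ext, ext_self, inner_zero_left, inner_zero_right, sub_zero, zero_sub,
    inner_neg_left]
  rw [real_inner_comm (coordD w Y) v]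
  ring

/-- By `koszul_eq` the Koszul expression is a linear form in `w`, so the basis sum defining `nabla`
is its Riesz representative. -/
lemma inner_nabla {x : M} {Y : VF E M} (hY : SmoothVFAt Y x) (v w : TangentSpace 𝓘(ℝ, E) x) :
    ⟪nabla v Y, w⟫_ℝ = koszul v Y w := by
  let κ : TangentSpace 𝓘(ℝ, E) x →ₗ[ℝ] ℝ :=
    { toFun := fun w ↦ koszul v Y w
      map_add' := fun a b ↦ by
        simp only [koszul_eq hY, inner_add_right, metricD_add_right, metricD_add,
          metricD_add_dir]
        ring
      map_smul' := fun c a ↦ by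
        simp only [koszul_eq hY, real_inner_smul_right, metricD_smul_right, metricD_smul,
          metricD_smul_dir, smul_eq_mul, RingHom.id_apply]
        ring }
  set b := stdOrthonormalBasis ℝ (TangentSpace 𝓘(ℝ, E) x)
  have h : koszul v Y w = κ (∑ i, ⟪b i, w⟫_ℝ • b i) := by rw [b.sum_repr' w]; rfl
  rw [h, nabla, map_sum, sum_inner]
  refine Finset.sum_congr rfl fun i _ ↦ ?_
  rw [map_smul, real_inner_smul_left, smul_eq_mul, mul_comm]
  rfl

/-- The Christoffel symbols at `x` in the preferred chart at `x`. -/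
def christoffel (x : M) : TangentSpace 𝓘(ℝ, E) x →ₗ[ℝ] TangentSpace 𝓘(ℝ, E) x →ₗ[ℝ]
    TangentSpace 𝓘(ℝ, E) x :=
  LinearMap.mk₂ ℝ (fun v u ↦ nabla v (ext u))
    (fun v v' u ↦ by
      refine ext_inner_right ℝ fun w ↦ ?_
      simp only [inner_add_left, inner_nabla (smooth_ext _), koszul_eq (smooth_ext _), coordD_ext,
        ext_self, metricD_add_right, metricD_add, metricD_add_dir, inner_zero_left]
      ring)
    (fun c v u ↦ by
      refine ext_inner_right ℝ fun w ↦ ?_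
      simp only [real_inner_smul_left, inner_nabla (smooth_ext _), koszul_eq (smooth_ext _),
        coordD_ext, ext_self, metricD_smul_right, metricD_smul, metricD_smul_dir,
        inner_zero_left]
      ring)
    (fun v u u' ↦ by
      refine ext_inner_right ℝ fun w ↦ ?_
      simp only [inner_add_left, inner_nabla (smooth_ext _), koszul_eq (smooth_ext _), coordD_ext,
        ext_self, metricD_add_right, metricD_add, metricD_add_dir, inner_zero_left]
      ring)
    (fun c v u ↦ by
      refine ext_inner_right ℝ fun w ↦ ?_
      simp only [real_inner_smul_left, inner_nabla (smooth_ext _), koszul_eq (smooth_ext _),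
        coordD_ext, ext_self, metricD_smul_right, metricD_smul, metricD_smul_dir,
        inner_zero_left]
      ring)

lemma christoffel_apply {x : M} (v u : TangentSpace 𝓘(ℝ, E) x) :
    christoffel x v u = nabla v (ext u) := rfl

lemma inner_christoffel {x : M} (v u w : TangentSpace 𝓘(ℝ, E) x) :
    ⟪christoffel x v u, w⟫_ℝ = (metricD v u w + metricD u w v - metricD w v u) / 2 := by
  rw [christoffel_apply, inner_nabla (smooth_ext _), koszul_eq (smooth_ext _), coordD_ext]
  simp

lemma christoffel_comm {x : M} (u v : TangentSpace 𝓘(ℝ, E) x) :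
    christoffel x u v = christoffel x v u := by
  refine ext_inner_right ℝ fun w ↦ ?_
  rw [inner_christoffel, inner_christoffel, metricD_comm u v w, metricD_comm v w u,
    metricD_comm w u v]
  ring

lemma metricD_eq {x : M} (v a b : TangentSpace 𝓘(ℝ, E) x) :
    metricD v a b = ⟪christoffel x v a, b⟫_ℝ + ⟪a, christoffel x v b⟫_ℝ := by
  rw [real_inner_comm (christoffel x v b) a, inner_christoffel, inner_christoffel, metricD_comm v b a,
    metricD_comm a b v, metricD_comm b v a]
  ring

lemma nabla_eq {x : M} {Y : VF E M} (hY : SmoothVFAt Y x) (v : TangentSpace 𝓘(ℝ, E) x) :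
    nabla v Y = coordD v Y + christoffel x v (Y x) := by
  refine ext_inner_right ℝ fun w ↦ ?_
  rw [inner_add_left, inner_nabla hY, inner_christoffel, koszul_eq hY]

lemma nabla_congr {x : M} {X Y : VF E M} (hY : SmoothVFAt Y x) (h : X =ᶠ[𝓝 x] Y)
    (v : TangentSpace 𝓘(ℝ, E) x) : nabla v X = nabla v Y := by
  have hX : SmoothVFAt X x := by
    refine ContMDiffAt.congr_of_eventuallyEq hY ?_
    filter_upwards [h] with y hy
    rw [hy]
  rw [nabla_eq hX, nabla_eq hY, coordD_congr v h, h.eq_of_nhds]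

end LeviCivita

/-! ### Pointwise algebra of Sasaki structures -/

section Algebra

variable {V : Type*} [NormedAddCommGroup V] [InnerProductSpace ℝ V]

/-- The pointwise algebra behind the identity `(∇_X φ) Y = g(X,Y) ξ - η(Y) X` on Sasaki manifolds:
`A` plays the role of `∇ξ` and `C` that of `∇φ`. -/
lemma sasaki_algebra (φ : V →ₗ[ℝ] V) (ξ : V) (A : V → V) (C : V → V → V)
    (h2 : ∀ v, φ (φ v) = -v + ⟪ξ, v⟫_ℝ • ξ) (hφξ : φ ξ = 0)
    (hφ : ∀ u v, ⟪φ u, v⟫_ℝ = -⟪u, φ v⟫_ℝ)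
    (ha : ∀ X Y, ⟪A X, Y⟫_ℝ - ⟪A Y, X⟫_ℝ = 2 * ⟪X, φ Y⟫_ℝ)
    (hs : ∀ X Y Z, ⟪C X Y, Z⟫_ℝ = -⟪C X Z, Y⟫_ℝ)
    (hc : ∀ X Y Z, ⟪C X Y, Z⟫_ℝ + ⟪C Y Z, X⟫_ℝ + ⟪C Z X, Y⟫_ℝ = 0)
    (hN : ∀ Y Z, C (φ Y) Z - C (φ Z) Y + φ (C Z Y) - φ (C Y Z) + (2 * ⟪Y, φ Z⟫_ℝ) • ξ = 0)
    (hCξ : ∀ X, C X ξ = -φ (A X)) (hAξ : ∀ X, ⟪A X, ξ⟫_ℝ = 0)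
    (hd : ∀ X Y Z, ⟪C X (φ Y), Z⟫_ℝ - ⟪C X Y, φ Z⟫_ℝ =
      ⟪A X, Y⟫_ℝ * ⟪ξ, Z⟫_ℝ + ⟪ξ, Y⟫_ℝ * ⟪A X, Z⟫_ℝ) (X Y : V) :
    C X Y = ⟪X, Y⟫_ℝ • ξ - ⟪ξ, Y⟫_ℝ • X := by
  have hξφ : ∀ v, ⟪ξ, φ v⟫_ℝ = 0 := fun v ↦ by
    have := hφ ξ v
    rw [hφξ, inner_zero_left] at this
    linarith
  have hN' : ∀ Y Z W, ⟪C (φ Y) Z, W⟫_ℝ - ⟪C (φ Z) Y, W⟫_ℝ - ⟪C Z Y, φ W⟫_ℝ + ⟪C Y Z, φ W⟫_ℝ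
      + 2 * ⟪Y, φ Z⟫_ℝ * ⟪ξ, W⟫_ℝ = 0 := fun Y Z W ↦ by
    have := congrArg (fun v ↦ ⟪v, W⟫_ℝ) (hN Y Z)
    simp only [inner_add_left, inner_sub_left, hφ, real_inner_smul_left, inner_zero_left] at this
    linarith
  have hCξ' : ∀ X Y, ⟪C X Y, ξ⟫_ℝ = -⟪A X, φ Y⟫_ℝ := fun X Y ↦ by
    rw [hs, hCξ, inner_neg_left, hφ]; ring
  have hA2 : ∀ X Y, ⟪A X, φ (φ Y)⟫_ℝ = -⟪A X, Y⟫_ℝ := fun X Y ↦ by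
    rw [h2, inner_add_right, inner_neg_right, real_inner_smul_right, hAξ]; ring
  have hAξ' : ∀ Y, ⟪A ξ, Y⟫_ℝ = 0 := fun Y ↦ by
    have := ha ξ Y
    rw [hAξ, hξφ] at this
    linarith
  -- `A` is a bare function, not assumed linear, so `φ²` in its argument is handled by exchanging
  -- the two slots with `ha`.
  have hA2' : ∀ X Y, ⟪A (φ (φ X)), Y⟫_ℝ = -⟪A X, Y⟫_ℝ := fun X Y ↦ by
    have h3 := ha (φ (φ X)) Y
    have h4 := ha X Y
    rw [hA2, h2 X, inner_add_left, real_inner_smul_left, hξφ, inner_neg_left] at h3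
    rw [h2 X]
    linarith
  -- `C` is not assumed linear either; this is needed for `C (φ ξ) Y`.
  have hC0 : ∀ Y Z, ⟪C 0 Y, Z⟫_ℝ = 0 := fun Y Z ↦ by
    have h3 := hc 0 Y Z
    have h4 := hs Z 0 Y
    rw [inner_zero_right] at h3 h4
    linarith
  -- Normality and closedness with one argument equal to `ξ`: the symmetric part of `∇ξ` vanishes on
  -- the image of `φ`, which is the Killing property of `ξ`.
  have hT0 : ∀ Y W, ⟪A (φ Y), φ W⟫_ℝ = -⟪A (φ W), φ Y⟫_ℝ := fun Y W ↦ by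
    have h3 := hN' Y ξ W
    rw [hφξ, hC0, inner_zero_right, hs (φ Y) ξ W, hs Y ξ (φ W), hCξ', hCξ', hA2] at h3
    have h4 := hc ξ Y (φ W)
    rw [hCξ', hs (φ W) ξ Y, hCξ', hA2] at h4
    linarith
  have hT1 : ∀ Y W, ⟪A (φ Y), φ W⟫_ℝ = ⟪φ Y, φ (φ W)⟫_ℝ := fun Y W ↦ by
    have h3 := ha (φ Y) (φ W)
    have h4 := hT0 Y W
    linarith
  -- That is, `∇_Y ξ = -φ Y`: the skew part is given by `ha`, and applying `hT1` to `φ Y` and `φ W`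
  -- extends the formula from the image of `φ` to all vectors.
  have hT : ∀ Y W, ⟪A Y, W⟫_ℝ = ⟪Y, φ W⟫_ℝ := fun Y W ↦ by
    have h3 := hT1 (φ Y) (φ W)
    rw [hA2, hA2', h2 (φ W), hξφ, zero_smul, add_zero, inner_neg_right, h2 Y, inner_add_left,
      real_inner_smul_left, hξφ, inner_neg_left] at h3
    linarith
  have hΦ : ∀ u v, ⟪u, φ v⟫_ℝ = -⟪v, φ u⟫_ℝ := fun u v ↦ by
    rw [← hφ v u, real_inner_comm]
  -- A Koszul-type combination: normality, two cyclic identities, skewness of `C` and three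
  -- instances of differentiated compatibility leave the single unknown `C W (φ Y)`. The `hΦ`
  -- rewrites bring the values of `g(·, φ ·)` to a common order of arguments.
  have hm : ∀ W Y Z, ⟪C W (φ Y), Z⟫_ℝ = ⟪W, φ Y⟫_ℝ * ⟪ξ, Z⟫_ℝ := fun W Y Z ↦ by
    have n := hN' Y Z W
    have c1 := hc (φ Y) Z W
    have c2 := hc (φ Z) Y W
    have s1 := hs Z (φ W) Y
    have s2 := hs Y (φ W) Z
    have s3 := hs W (φ Z) Y
    have d1 := hd Z W Y
    have d2 := hd Y W Z
    have d3 := hd W Y Z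
    rw [hT] at d1 d2 d3
    rw [hT] at d1 d2 d3
    rw [hΦ Y Z] at *
    rw [hΦ Z W, hΦ Z Y] at *
    rw [hΦ Y W] at *
    linarith
  -- Put `φ Y` for `Y` in `hm`. Skewness moves `φ²` to the other slot, and the `ξ`-component lost by
  -- `φ²` is supplied by `hCξ'`.
  have hz : ∀ Z, ⟪C X Y, Z⟫_ℝ = ⟪X, Y⟫_ℝ * ⟪ξ, Z⟫_ℝ - ⟪ξ, Y⟫_ℝ * ⟪X, Z⟫_ℝ := fun Z ↦ by
    have h3 := hm X (φ Y) Z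
    have h4 := hs X (φ (φ Y)) Z
    have h5 := hs X Y Z
    have h6 := hCξ' X Z
    rw [hT, h2, inner_add_right, inner_neg_right, real_inner_smul_right] at h6
    rw [h2, inner_add_right (C X Z), inner_neg_right, real_inner_smul_right, h6] at h4
    rw [h2, inner_add_right X, inner_neg_right, real_inner_smul_right] at h3
    linarith
  refine ext_inner_right ℝ fun Z ↦ ?_
  rw [hz, inner_sub_left, real_inner_smul_left, real_inner_smul_left]

end Algebra

/-! ### Metricity, absence of torsion, covariant derivative of endomorphisms -/

section Tensor

variable {E : Type*} [NormedAddCommGroup E] [NormedSpace ℝ E] [FiniteDimensional ℝ E]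
  {M : Type*} [TopologicalSpace M] [ChartedSpace E M] [IsManifold 𝓘(ℝ, E) ∞ M]
  [RiemannianBundle (fun x : M ↦ TangentSpace 𝓘(ℝ, E) x)]
  [IsContMDiffRiemannianBundle 𝓘(ℝ, E) ∞ E (fun x : M ↦ TangentSpace 𝓘(ℝ, E) x)]

/-- The Levi-Civita connection is metric. -/
lemma mvfderiv_inner_nabla {x : M} {X Y : VF E M} (hX : SmoothVFAt X x) (hY : SmoothVFAt Y x)
    (v : TangentSpace 𝓘(ℝ, E) x) :
    mvfderiv 𝓘(ℝ, E) (fun y ↦ ⟪X y, Y y⟫_ℝ) x v = ⟪nabla v X, Y x⟫_ℝ + ⟪X x, nabla v Y⟫_ℝ := by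
  rw [mvfderiv_inner hX hY, metricD_eq, nabla_eq hX, nabla_eq hY, inner_add_left, inner_add_right]
  ring

/-- The Levi-Civita connection is torsion-free. -/
lemma mlieBracket_eq_nabla {x : M} {X Y : VF E M} (hX : SmoothVFAt X x) (hY : SmoothVFAt Y x) :
    mlieBracket 𝓘(ℝ, E) X Y x = nabla (X x) Y - nabla (Y x) X := by
  rw [mlieBracket_eq hX hY, nabla_eq hX, nabla_eq hY, christoffel_comm (Y x)]
  abel

lemma SmoothEnd.app {A : EndField E M} (hA : SmoothEnd A) {x : M} {X : VF E M}
    (hX : SmoothVFAt X x) : SmoothVFAt (app A X) x :=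
  ContMDiffAt.clm_bundle_apply (F₁ := E) (F₂ := E) (E₁ := fun x : M ↦ TangentSpace 𝓘(ℝ, E) x)
    (E₂ := fun x : M ↦ TangentSpace 𝓘(ℝ, E) x) (IB := 𝓘(ℝ, E)) hA.contMDiffAt hX

/-- The covariant derivative `(∇_v A) u` of an endomorphism field. -/
def covEnd (A : EndField E M) {x : M} (v u : TangentSpace 𝓘(ℝ, E) x) : TangentSpace 𝓘(ℝ, E) x :=
  nabla v (app A (ext u)) - A x (nabla v (ext u))

lemma coordD_app {A : EndField E M} (hA : SmoothEnd A) {x : M} {Y : VF E M}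
    (hY : SmoothVFAt Y x) (v : TangentSpace 𝓘(ℝ, E) x) :
    coordD v (app A Y) = coordD v (app A (ext (Y x))) + A x (coordD v Y) := by
  have := (leibniz (x := x) (fun y ↦ ((triv E x).continuousLinearMapAt ℝ y).toLinearMap ∘ₗ
    (A y).toLinearMap) (fun u ↦ rep_mdiff (hA.app (smooth_ext u))) hY).2 v
  have h2 := congrArg ((triv E x).symmL ℝ x) this
  rw [map_add] at h2
  refine h2.trans ?_
  congr 1
  exact (triv E x).symmL_continuousLinearMapAt (mem_triv x) _

/-- Besides the product rule, this shows that `covEnd` does not depend on the chosen extension of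
the vector. -/
lemma nabla_app {A : EndField E M} (hA : SmoothEnd A) {x : M} {Y : VF E M}
    (hY : SmoothVFAt Y x) (v : TangentSpace 𝓘(ℝ, E) x) :
    nabla v (app A Y) = covEnd A v (Y x) + A x (nabla v Y) := by
  rw [covEnd, nabla_eq (hA.app hY), coordD_app hA hY, nabla_eq (hA.app (smooth_ext _)),
    nabla_eq hY, nabla_eq (smooth_ext _), coordD_ext]
  simp only [app, ext_self, map_add, zero_add]
  abel

end Tensor

/-! ### Covariant derivative of `φ` on a Sasaki manifold -/

section Sasaki

variable {E : Type*} [NormedAddCommGroup E] [NormedSpace ℝ E] [FiniteDimensional ℝ E]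
  {M : Type*} [TopologicalSpace M] [ChartedSpace E M] [IsManifold 𝓘(ℝ, E) ∞ M]
  [RiemannianBundle (fun x : M ↦ TangentSpace 𝓘(ℝ, E) x)]
  {φ : EndField E M} {ξ : VF E M} {η : OneForm E M}

namespace IsAlmostContactMetric

/-- From `φ² ξ = 0` the formula for `φ²` at `φ ξ` gives `φ ξ = c ξ`; then `c² ξ = φ² ξ = 0`, so `c =
0`. -/
lemma phi_xi (h : IsAlmostContactMetric φ ξ η) (x : M) : φ x (ξ x) = 0 := by
  have h1 : φ x (φ x (ξ x)) = 0 := by rw [h.phi_phi, h.eta_xi]; simp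
  have h2 := h.phi_phi x (φ x (ξ x))
  rw [h1, map_zero] at h2
  have h3 : φ x (ξ x) = η x (φ x (ξ x)) • ξ x := by
    rw [eq_comm, neg_add_eq_zero] at h2; exact h2
  set c := η x (φ x (ξ x)) with hc
  have h4 : (c * c) • ξ x = 0 := by
    rw [h3, map_smul, h3, smul_smul] at h1; exact h1
  have h5 := congrArg (η x) h4
  rw [map_smul, h.eta_xi, map_zero] at h5
  have h6 : c = 0 := by simpa using h5
  rw [h3, h6, zero_smul]

lemma eta_phi (h : IsAlmostContactMetric φ ξ η) (x : M) (v : TangentSpace 𝓘(ℝ, E) x) :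
    η x (φ x v) = 0 := by
  have h1 := h.phi_phi x (φ x v)
  rw [h.phi_phi x v, map_add, map_smul, h.phi_xi, map_neg, smul_zero, add_zero, left_eq_add] at h1
  have h5 := congrArg (η x) h1
  rwa [map_smul, h.eta_xi, map_zero, smul_eq_mul, mul_one] at h5

/-- Compatibility with one argument equal to `ξ`, where `φ ξ = 0`. -/
lemma eta_eq (h : IsAlmostContactMetric φ ξ η) (x : M) (v : TangentSpace 𝓘(ℝ, E) x) :
    η x v = ⟪ξ x, v⟫_ℝ := by
  have := h.compatible x (ξ x) v
  rw [h.phi_xi, inner_zero_left, h.eta_xi] at this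
  linarith

lemma inner_phi (h : IsAlmostContactMetric φ ξ η) (x : M) (u v : TangentSpace 𝓘(ℝ, E) x) :
    ⟪φ x u, v⟫_ℝ = -⟪u, φ x v⟫_ℝ := by
  have := h.compatible x u (φ x v)
  rw [h.phi_phi, h.eta_phi, inner_add_right, real_inner_smul_right,
    real_inner_comm (ξ x), ← h.eta_eq x (φ x u), h.eta_phi, inner_neg_right] at this
  linarith

end IsAlmostContactMetric

variable [IsContMDiffRiemannianBundle 𝓘(ℝ, E) ∞ E (fun x : M ↦ TangentSpace 𝓘(ℝ, E) x)]

/-- The fundamental 2-form of a contact metric manifold is closed. -/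
lemma IsContactMetric.cyclic {m : ℕ} (h : IsContactMetric m φ ξ η) {x : M}
    (u v w : TangentSpace 𝓘(ℝ, E) x) :
    ⟪u, covEnd φ v w⟫_ℝ + ⟪w, covEnd φ u v⟫_ℝ + ⟪v, covEnd φ w u⟫_ℝ = 0 := by
  have hf : ∀ w : TangentSpace 𝓘(ℝ, E) x,
      ContMDiffAt 𝓘(ℝ, E) 𝓘(ℝ, ℝ) ∞ (fun y ↦ η y (ext w y)) x := fun w ↦ by
    simp only [h.eta_eq]
    exact smooth_inner (h.smooth_xi x) (smooth_ext w)
  set DD : TangentSpace 𝓘(ℝ, E) x → TangentSpace 𝓘(ℝ, E) x → TangentSpace 𝓘(ℝ, E) x → ℝ :=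
    fun a b w ↦ mvfderiv 𝓘(ℝ, E)
      (fun y ↦ mvfderiv 𝓘(ℝ, E) (fun y ↦ η y (ext w y)) y (ext a y)) x b with hDD
  have hsymm : ∀ a b w, DD a b w = DD b a w := fun a b w ↦ mvfderiv_mvfderiv_ext_comm (hf w) a b
  -- The derivative along `v` of `Φ(u,w) = (∂_u η_w - ∂_w η_u) / 2`, computed once by metricity and
  -- once by coordinate derivatives; the bracket term of `dη` is absent for coordinate fields.
  have key : ∀ u v w : TangentSpace 𝓘(ℝ, E) x,
      ⟪nabla v (ext u), φ x w⟫_ℝ + ⟪u, covEnd φ v w + φ x (nabla v (ext w))⟫_ℝ =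
      (DD u v w - DD w v u) / 2 := by
    intro u v w
    have e1 : (fun y ↦ ⟪ext u y, app φ (ext w) y⟫_ℝ) =ᶠ[𝓝 x]
        fun y ↦ (1 / 2 : ℝ) • (mvfderiv 𝓘(ℝ, E) (fun y ↦ η y (ext w y)) y (ext u y) -
          mvfderiv 𝓘(ℝ, E) (fun y ↦ η y (ext u y)) y (ext w y)) := by
      filter_upwards [eventually_mem_triv (E := E) x] with y hy
      have := h.associated y (ext u) (ext w) (smoothVFAt_ext u hy) (smoothVFAt_ext w hy)
      rw [app, ← this, extDer, mlieBracket_ext u w hy, map_zero, smul_eq_mul]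
      ring
    have e2 := mvfderiv_inner_nabla (smooth_ext u) (h.smooth_phi.app (smooth_ext w)) v
    have d1 := (contMDiffAt_mvfderiv_ext (hf w) u).mdifferentiableAt (by simp)
    have d2 := (contMDiffAt_mvfderiv_ext (hf u) w).mdifferentiableAt (by simp)
    have d3 : MDifferentiableAt 𝓘(ℝ, E) 𝓘(ℝ, ℝ) (fun y ↦
      mvfderiv 𝓘(ℝ, E) (fun y ↦ η y (ext w y)) y (ext u y) -
          mvfderiv 𝓘(ℝ, E) (fun y ↦ η y (ext u y)) y (ext w y)) x := d1.sub d2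
    rw [mvfderiv_congr e1, mvfderiv_fun_smul mdifferentiableAt_const d3,
      mvfderiv_const, mvfderiv_fun_sub d1 d2, nabla_app h.smooth_phi (smooth_ext w)] at e2
    simp only [ext_self, app] at e2
    rw [← e2]
    simp [hDD]
    ring
  -- In the cyclic sum the second derivatives cancel by symmetry (`d² = 0`), and the Christoffel
  -- terms by their symmetry and the skewness of `φ`.
  have k1 := key u v w
  have k2 := key w u v
  have k3 := key v w u
  simp only [← christoffel_apply, inner_add_right] at k1 k2 k3
  rw [← neg_eq_iff_eq_neg.2 (h.inner_phi x u _)] at k1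
  rw [← neg_eq_iff_eq_neg.2 (h.inner_phi x w _), christoffel_comm u w] at k2
  rw [← neg_eq_iff_eq_neg.2 (h.inner_phi x v _), christoffel_comm w v, christoffel_comm w u] at k3
  rw [hsymm u v w, hsymm w v u] at k1
  rw [hsymm w u v] at k2
  rw [christoffel_comm u v] at k2
  rw [christoffel_comm u w] at k3
  rw [real_inner_comm (φ x w)] at k1
  rw [real_inner_comm (φ x v)] at k2
  rw [real_inner_comm (φ x u)] at k3
  linarith

/-- On a Sasaki manifold `(∇_v φ) u = g(v,u) ξ - η(u) v`. -/
theorem IsSasaki.covEnd_phi {m : ℕ} (h : IsSasaki m φ ξ η) {x : M}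
    (v u : TangentSpace 𝓘(ℝ, E) x) :
    covEnd φ v u = ⟪v, u⟫_ℝ • ξ x - η x u • v := by
  have hxi := h.smooth_xi x
  have happ := fun u : TangentSpace 𝓘(ℝ, E) x ↦ h.smooth_phi.app (smooth_ext u)
  have hs : ∀ X Y Z : TangentSpace 𝓘(ℝ, E) x, ⟪covEnd φ X Y, Z⟫_ℝ = -⟪covEnd φ X Z, Y⟫_ℝ := by
    intro X Y Z
    have e : (fun y ↦ ⟪app φ (ext Y) y, ext Z y⟫_ℝ) = fun y ↦ -⟪ext Y y, app φ (ext Z) y⟫_ℝ := by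
      ext y; exact h.inner_phi y _ _
    have e1 := mvfderiv_inner_nabla (happ Y) (smooth_ext Z) X
    rw [e, mvfderiv_fun_neg] at e1
    have e2 := mvfderiv_inner_nabla (smooth_ext Y) (happ Z) X
    rw [neg_apply, e2, nabla_app h.smooth_phi (smooth_ext _),
      nabla_app h.smooth_phi (smooth_ext _)] at e1
    simp only [ext_self, app, inner_add_left, inner_add_right] at e1
    have e3 := h.inner_phi x Y (nabla X (ext Z))
    have e4 := h.inner_phi x (nabla X (ext Y)) Z
    rw [real_inner_comm Y (covEnd φ X Z)]
    linarith
  have hAξ : ∀ X : TangentSpace 𝓘(ℝ, E) x, ⟪nabla X ξ, ξ x⟫_ℝ = 0 := by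
    intro X
    have e1 := mvfderiv_inner_nabla hxi hxi X
    have e : (fun y ↦ ⟪ξ y, ξ y⟫_ℝ) = fun _ ↦ 1 := by
      ext y; rw [← h.eta_eq, h.eta_xi]
    rw [e, mvfderiv_const, real_inner_comm (nabla X ξ)] at e1
    simp at e1
    linarith
  rw [h.eta_eq]
  -- Remaining goals, in order: the formula for `dη`; closedness of the fundamental form; normality
  -- with brackets expressed by `∇`; the derivative of `φ ξ = 0`; the derivative of the
  -- compatibility of `φ` with `g`.
  refine sasaki_algebra (φ x).toLinearMap (ξ x) (fun X ↦ nabla X ξ) (fun X Y ↦ covEnd φ X Y)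
    (fun v ↦ by simpa [h.eta_eq] using h.phi_phi x v) (h.phi_xi x) (h.inner_phi x) ?_ hs ?_ ?_ ?_
    hAξ ?_ v u
  · intro X Y
    have e1 := h.associated x (ext X) (ext Y) (smooth_ext X) (smooth_ext Y)
    rw [extDer, mlieBracket_ext X Y (mem_triv x)] at e1
    simp only [h.eta_eq, mvfderiv_inner_nabla hxi (smooth_ext _), ext_self, inner_zero_right,
      ← christoffel_apply] at e1
    rw [christoffel_comm Y X] at e1
    simp only [ContinuousLinearMap.coe_coe]
    linarith
  · intro X Y Z
    have e := h.toIsContactMetric.cyclic Z X Y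
    simp only [real_inner_comm (covEnd φ _ _)] at e
    linarith
  · intro Y Z
    have e := h.normal x (ext Y) (ext Z) (smooth_ext Y) (smooth_ext Z)
    rw [h.associated x (ext Y) (ext Z) (smooth_ext Y) (smooth_ext Z), nijenhuis,
      mlieBracket_eq_nabla (smooth_ext Y) (smooth_ext Z),
      mlieBracket_eq_nabla (happ Y) (happ Z),
      mlieBracket_eq_nabla (happ Y) (smooth_ext Z),
      mlieBracket_eq_nabla (smooth_ext Y) (happ Z)] at e
    simp only [nabla_app h.smooth_phi (smooth_ext _), ext_self] at e
    simp only [app, ext_self, map_sub, map_add] at e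
    simp only [ContinuousLinearMap.coe_coe]
    rw [← e]
    abel
  · intro X
    have e1 := nabla_app h.smooth_phi hxi X
    have e2 : nabla X (app φ ξ) = 0 := by
      refine ext_inner_right ℝ fun Z ↦ ?_
      have e3 := mvfderiv_inner_nabla (h.smooth_phi.app hxi) (smooth_ext Z) X
      simp only [app, h.phi_xi, inner_zero_left, mvfderiv_const, zero_apply, add_zero,
        ext_self] at e3
      rw [inner_zero_left]
      exact e3.symm
    rw [e2] at e1
    exact eq_neg_of_add_eq_zero_left e1.symm
  · intro X Y Z
    have e : (fun y ↦ ⟪app φ (ext Y) y, app φ (ext Z) y⟫_ℝ) =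
        fun y ↦ ⟪ext Y y, ext Z y⟫_ℝ - ⟪ξ y, ext Y y⟫_ℝ * ⟪ξ y, ext Z y⟫_ℝ := by
      ext y
      rw [← h.eta_eq, ← h.eta_eq]
      exact h.compatible y _ _
    have e1 := mvfderiv_inner_nabla (happ Y) (happ Z) X
    have dY := mdiff_inner hxi (smooth_ext Y)
    have dZ := mdiff_inner hxi (smooth_ext Z)
    have dYZ : MDifferentiableAt 𝓘(ℝ, E) 𝓘(ℝ, ℝ)
      (fun y ↦ ⟪ξ y, ext Y y⟫_ℝ * ⟪ξ y, ext Z y⟫_ℝ) x := dY.mul dZ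
    rw [e, mvfderiv_fun_sub (mdiff_inner (smooth_ext Y) (smooth_ext Z)) dYZ,
      mvfderiv_fun_mul dY dZ] at e1
    simp only [sub_apply, add_apply, smul_apply, smul_eq_mul, mvfderiv_inner_nabla hxi (smooth_ext _),
      mvfderiv_inner_nabla (smooth_ext Y) (smooth_ext _), nabla_app h.smooth_phi (smooth_ext _),
      ext_self] at e1
    simp only [app, ext_self, inner_add_left, inner_add_right, h.compatible] at e1
    have e2 := hs X Z (φ x Y)
    rw [real_inner_comm] at e2
    simp only [h.eta_eq] at e1
    simp only [ContinuousLinearMap.coe_coe]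
    linarith

end Sasaki

/-! ### Hessians of vector-valued functions -/

section Hessian

variable {E : Type*} [NormedAddCommGroup E] [NormedSpace ℝ E] [FiniteDimensional ℝ E]
  {M : Type*} [TopologicalSpace M] [ChartedSpace E M] [IsManifold 𝓘(ℝ, E) ∞ M]
  [RiemannianBundle (fun x : M ↦ TangentSpace 𝓘(ℝ, E) x)]
  [IsContMDiffRiemannianBundle 𝓘(ℝ, E) ∞ E (fun x : M ↦ TangentSpace 𝓘(ℝ, E) x)]
  {W : Type*} [NormedAddCommGroup W] [NormedSpace ℝ W]

lemma mdiff_mvfderiv_ext {x : M} {f : M → W} (hf : ContMDiffAt 𝓘(ℝ, E) 𝓘(ℝ, W) ∞ f x)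
    (u : TangentSpace 𝓘(ℝ, E) x) :
    MDifferentiableAt 𝓘(ℝ, E) 𝓘(ℝ, W) (fun y ↦ mvfderiv 𝓘(ℝ, E) f y (ext u y)) x :=
  (contMDiffAt_mvfderiv_ext hf u).mdifferentiableAt (by simp)

/-- The Hessian of a smooth function with values in a vector space. -/
def hessian {x : M} {f : M → W} (hf : ContMDiffAt 𝓘(ℝ, E) 𝓘(ℝ, W) ∞ f x) :
    TangentSpace 𝓘(ℝ, E) x →ₗ[ℝ] TangentSpace 𝓘(ℝ, E) x →ₗ[ℝ] W :=
  LinearMap.mk₂ ℝ (fun v u ↦ mvfderiv 𝓘(ℝ, E) (fun y ↦ mvfderiv 𝓘(ℝ, E) f y (ext u y)) x v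
      - mvfderiv 𝓘(ℝ, E) f x (christoffel x v u))
    (fun v v' u ↦ by simp only [map_add, LinearMap.add_apply]; abel)
    (fun c v u ↦ by simp only [map_smul, LinearMap.smul_apply, smul_sub])
    (fun v u u' ↦ by
      have : (fun y ↦ mvfderiv 𝓘(ℝ, E) f y (ext (u + u') y)) =ᶠ[𝓝 x]
          fun y ↦ mvfderiv 𝓘(ℝ, E) f y (ext u y) + mvfderiv 𝓘(ℝ, E) f y (ext u' y) := by
        filter_upwards [eventually_mem_triv (E := E) x] with y hy
        rw [ext_add _ _ hy, map_add]
      rw [mvfderiv_congr this, mvfderiv_fun_add (mdiff_mvfderiv_ext hf u)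
        (mdiff_mvfderiv_ext hf u')]
      simp only [map_add, add_apply]
      abel)
    (fun c v u ↦ by
      have : (fun y ↦ mvfderiv 𝓘(ℝ, E) f y (ext (c • u) y)) =ᶠ[𝓝 x]
          fun y ↦ c • mvfderiv 𝓘(ℝ, E) f y (ext u y) := by
        filter_upwards [eventually_mem_triv (E := E) x] with y hy
        rw [ext_smul _ _ hy, map_smul]
      rw [mvfderiv_congr this, mvfderiv_fun_smul mdifferentiableAt_const
        (mdiff_mvfderiv_ext hf u), mvfderiv_const]
      simp [smul_sub])

lemma hessian_comm {x : M} {f : M → W} (hf : ContMDiffAt 𝓘(ℝ, E) 𝓘(ℝ, W) ∞ f x)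
    (u v : TangentSpace 𝓘(ℝ, E) x) : hessian hf u v = hessian hf v u := by
  simp only [hessian, LinearMap.mk₂_apply]
  rw [mvfderiv_mvfderiv_ext_comm hf, christoffel_comm]

/-- `v (df(Y)) = Hess f(v, Y) + df(∇_v Y)`. -/
lemma mvfderiv_mvfderiv {x : M} {f : M → W} (hf : ContMDiffAt 𝓘(ℝ, E) 𝓘(ℝ, W) ∞ f x)
    {Y : VF E M} (hY : SmoothVFAt Y x) (v : TangentSpace 𝓘(ℝ, E) x) :
    mvfderiv 𝓘(ℝ, E) (fun y ↦ mvfderiv 𝓘(ℝ, E) f y (Y y)) x v =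
      hessian hf v (Y x) + mvfderiv 𝓘(ℝ, E) f x (nabla v Y) := by
  have := (leibniz (x := x) (fun y ↦ (mvfderiv 𝓘(ℝ, E) f y).toLinearMap)
    (fun u ↦ mdiff_mvfderiv_ext hf u) hY).2 v
  refine this.trans ?_
  rw [nabla_eq hY, hessian, LinearMap.mk₂_apply, map_add]
  simp

end Hessian

/-! ### Second fundamental form of a map -/

section Maps

variable {E : Type*} [NormedAddCommGroup E] [NormedSpace ℝ E] [FiniteDimensional ℝ E]
  {M : Type*} [TopologicalSpace M] [ChartedSpace E M] [IsManifold 𝓘(ℝ, E) ∞ M]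
  {F : Type*} [NormedAddCommGroup F] [NormedSpace ℝ F] [FiniteDimensional ℝ F]
  {N : Type*} [TopologicalSpace N] [ChartedSpace F N] [IsManifold 𝓘(ℝ, F) ∞ N]

/-- A map read in the preferred chart of the target. -/
def localMap (F : Type*) [NormedAddCommGroup F] [NormedSpace ℝ F] {M N : Type*}
    [TopologicalSpace N] [ChartedSpace F N] (ψ : M → N) (x : M) (y : M) : F :=
  extChartAt 𝓘(ℝ, F) (ψ x) (ψ y)

lemma localMap_contMDiffAt {ψ : M → N} {x : M} (hψ : ContMDiffAt 𝓘(ℝ, E) 𝓘(ℝ, F) ∞ ψ x) :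
    ContMDiffAt 𝓘(ℝ, E) 𝓘(ℝ, F) ∞ (localMap F ψ x) x :=
  contMDiffAt_extChartAt.comp x hψ

/-- The trivialization at `ψ x` is the differential of the chart there, so this is the chain rule.
-/
lemma triv_mfderiv {ψ : M → N} {x y : M} (hψ : ContMDiffAt 𝓘(ℝ, E) 𝓘(ℝ, F) ∞ ψ y)
    (hy : ψ y ∈ (triv F (ψ x)).baseSet) (w : TangentSpace 𝓘(ℝ, E) y) :
    (triv F (ψ x)).continuousLinearMapAt ℝ (ψ y) (mfderiv 𝓘(ℝ, E) 𝓘(ℝ, F) ψ y w) =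
      mvfderiv 𝓘(ℝ, E) (localMap F ψ x) y w := by
  have hs := mem_triv_iff.1 hy
  have h1 := TangentBundle.continuousLinearMapAt_trivializationAt (I := 𝓘(ℝ, F)) hs
  have h2 : MDifferentiableAt 𝓘(ℝ, F) 𝓘(ℝ, F) (extChartAt 𝓘(ℝ, F) (ψ x)) (ψ y) :=
    (contMDiffAt_extChartAt' hs : ContMDiffAt 𝓘(ℝ, F) 𝓘(ℝ, F) ∞ _ _).mdifferentiableAt (by simp)
  have h3 := mfderiv_comp_apply y h2 (hψ.mdifferentiableAt (by simp)) w
  exact (congrArg (fun A ↦ A (mfderiv 𝓘(ℝ, E) 𝓘(ℝ, F) ψ y w)) h1).trans h3.symm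

lemma symmL_mvfderiv_localMap {ψ : M → N} {x : M} (hψ : ContMDiffAt 𝓘(ℝ, E) 𝓘(ℝ, F) ∞ ψ x)
    (w : TangentSpace 𝓘(ℝ, E) x) :
    (triv F (ψ x)).symmL ℝ (ψ x) (mvfderiv 𝓘(ℝ, E) (localMap F ψ x) x w) =
      mfderiv 𝓘(ℝ, E) 𝓘(ℝ, F) ψ x w := by
  rw [← triv_mfderiv hψ (mem_triv _), Trivialization.symmL_continuousLinearMapAt _ (mem_triv _)]

/-- Leibniz rule for fiberwise linear maps on `N` applied to sections along `ψ : M → N`. -/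
lemma leibniz_along {W : Type*} [NormedAddCommGroup W] [NormedSpace ℝ W]
    {ψ : M → N} {x : M} (hψ : MDifferentiableAt 𝓘(ℝ, E) 𝓘(ℝ, F) ψ x)
    (L : ∀ z : N, TangentSpace 𝓘(ℝ, F) z →ₗ[ℝ] W)
    (hL : ∀ u : TangentSpace 𝓘(ℝ, F) (ψ x),
      MDifferentiableAt 𝓘(ℝ, F) 𝓘(ℝ, W) (fun z ↦ L z (ext u z)) (ψ x))
    {c : M → F} (hc : MDifferentiableAt 𝓘(ℝ, E) 𝓘(ℝ, F) c x) (v : TangentSpace 𝓘(ℝ, E) x) :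
    mvfderiv 𝓘(ℝ, E) (fun y ↦ L (ψ y) ((triv F (ψ x)).symmL ℝ (ψ y) (c y))) x v =
      mvfderiv 𝓘(ℝ, F) (fun z ↦ L z (ext ((triv F (ψ x)).symmL ℝ (ψ x) (c x)) z)) (ψ x)
          (mfderiv 𝓘(ℝ, E) 𝓘(ℝ, F) ψ x v)
        + L (ψ x) ((triv F (ψ x)).symmL ℝ (ψ x) (mvfderiv 𝓘(ℝ, E) c x v)) := by
  set b := Module.finBasis ℝ F with hb
  have hbs : ∀ z ∈ (triv F (ψ x)).baseSet, ∀ w : F, (triv F (ψ x)).symmL ℝ z w =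
      ∑ i, b.repr w i • ext (frame (ψ x) i) z := fun z hz w ↦ by
    conv_lhs => rw [← b.sum_repr w]
    simp only [map_sum, map_smul, frame, ext_eq _ hz,
      Trivialization.continuousLinearMapAt_symmL _ (mem_triv (ψ x)), hb]
  have hsum : ∀ w : F, (triv F (ψ x)).symmL ℝ (ψ x) w = ∑ i, b.repr w i • frame (ψ x) i :=
    fun w ↦ by simpa using hbs _ (mem_triv _) w
  have e1 : (fun y ↦ L (ψ y) ((triv F (ψ x)).symmL ℝ (ψ y) (c y))) =ᶠ[𝓝 x]
      fun y ↦ ∑ i, b.repr (c y) i • L (ψ y) (ext (frame (ψ x) i) (ψ y)) := by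
    filter_upwards [hψ.continuousAt.eventually (eventually_mem_triv (E := F) (ψ x))] with y hy
    simp [hbs _ hy]
  have e2 : (fun z ↦ L z (ext ((triv F (ψ x)).symmL ℝ (ψ x) (c x)) z)) =ᶠ[𝓝 (ψ x)]
      fun z ↦ ∑ i, b.repr (c x) i • L z (ext (frame (ψ x) i) z) := by
    filter_upwards [eventually_mem_triv (E := F) (ψ x)] with z hz
    rw [hsum, ext_sum _ _ hz]
    simp
  have hci := fun i ↦ mvfderiv_clm_comp (b.coord i).toContinuousLinearMap hc
  have hLi : ∀ i, MDifferentiableAt 𝓘(ℝ, E) 𝓘(ℝ, W)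
      (fun y ↦ L (ψ y) (ext (frame (ψ x) i) (ψ y))) x := fun i ↦
    MDifferentiableAt.comp x (hL (frame (ψ x) i)) hψ
  have hLi' : ∀ i, mvfderiv 𝓘(ℝ, E) (fun y ↦ L (ψ y) (ext (frame (ψ x) i) (ψ y))) x v =
      mvfderiv 𝓘(ℝ, F) (fun z ↦ L z (ext (frame (ψ x) i) z)) (ψ x)
          (mfderiv 𝓘(ℝ, E) 𝓘(ℝ, F) ψ x v) := fun i ↦
    mfderiv_comp_apply x (hL (frame (ψ x) i)) hψ v
  rw [mvfderiv_congr e1, mvfderiv_congr e2,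
    (mvfderiv_sum (E := E) (M := M) (x := x) Finset.univ
      (f := fun i y ↦ b.repr (c y) i • L (ψ y) (ext (frame (ψ x) i) (ψ y)))
      (fun i _ ↦ (hci i).1.smul (hLi i))).2,
    (mvfderiv_sum (E := F) (M := N) (x := ψ x) Finset.univ
      (f := fun i z ↦ b.repr (c x) i • L z (ext (frame (ψ x) i) z))
      (fun i _ ↦ (mdifferentiableAt_const).smul (hL _))).2, hsum]
  simp only [map_sum, map_smul, sum_apply, ← Finset.sum_add_distrib]
  refine Finset.sum_congr rfl fun i _ ↦ ?_
  have h1 := mvfderiv_fun_smul (hci i).1 (hLi i)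
  refine (congrArg (fun A ↦ A v) h1).trans ?_
  rw [mvfderiv_fun_smul mdifferentiableAt_const (hL _), mvfderiv_const]
  simp only [add_apply, smul_apply, hLi']
  have h2 := (hci i).2 v
  simp only [LinearMap.coe_toContinuousLinearMap', Module.Basis.coord_apply] at h2
  simp
  exact congrArg (fun r : ℝ ↦ r • L (ψ x) (frame (ψ x) i)) h2

variable [RiemannianBundle (fun x : M ↦ TangentSpace 𝓘(ℝ, E) x)]
  [IsContMDiffRiemannianBundle 𝓘(ℝ, E) ∞ E (fun x : M ↦ TangentSpace 𝓘(ℝ, E) x)]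
  [RiemannianBundle (fun y : N ↦ TangentSpace 𝓘(ℝ, F) y)]
  [IsContMDiffRiemannianBundle 𝓘(ℝ, F) ∞ F (fun x : N ↦ TangentSpace 𝓘(ℝ, F) x)]

/-- The second fundamental form of a map as a bilinear map. -/
def secondForm {ψ : M → N} {x : M} (hψ : ContMDiffAt 𝓘(ℝ, E) 𝓘(ℝ, F) ∞ ψ x) :
    TangentSpace 𝓘(ℝ, E) x →ₗ[ℝ] TangentSpace 𝓘(ℝ, E) x →ₗ[ℝ] TangentSpace 𝓘(ℝ, F) (ψ x) :=
  (hessian (localMap_contMDiffAt hψ)).compr₂ ((triv F (ψ x)).symmL ℝ (ψ x)).toLinearMap +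
    (christoffel (ψ x)).compl₁₂ (mfderiv 𝓘(ℝ, E) 𝓘(ℝ, F) ψ x).toLinearMap
      (mfderiv 𝓘(ℝ, E) 𝓘(ℝ, F) ψ x).toLinearMap

lemma secondForm_apply {ψ : M → N} {x : M} (hψ : ContMDiffAt 𝓘(ℝ, E) 𝓘(ℝ, F) ∞ ψ x)
    (u v : TangentSpace 𝓘(ℝ, E) x) :
    secondForm hψ u v = (triv F (ψ x)).symmL ℝ (ψ x) (hessian (localMap_contMDiffAt hψ) u v) +
      christoffel (ψ x) (mfderiv 𝓘(ℝ, E) 𝓘(ℝ, F) ψ x u) (mfderiv 𝓘(ℝ, E) 𝓘(ℝ, F) ψ x v) := rfl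

lemma secondForm_comm {ψ : M → N} {x : M} (hψ : ContMDiffAt 𝓘(ℝ, E) 𝓘(ℝ, F) ∞ ψ x)
    (u v : TangentSpace 𝓘(ℝ, E) x) : secondForm hψ u v = secondForm hψ v u := by
  rw [secondForm_apply, secondForm_apply, hessian_comm, christoffel_comm]

/-- Replaces the formula through extensions by a form whose bilinearity and symmetry are available,
as the trace argument requires. -/
lemma hessMap_eq {ψ : M → N} (hψ : ContMDiff 𝓘(ℝ, E) 𝓘(ℝ, F) ∞ ψ) {x : M}
    (u v : TangentSpace 𝓘(ℝ, E) x) : hessMap ψ u v = secondForm (hψ x) u v := by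
  have e : (fun y ↦ (triv F (ψ x)).continuousLinearMapAt ℝ (ψ y)
      (mfderiv 𝓘(ℝ, E) 𝓘(ℝ, F) ψ y (ext v y))) =ᶠ[𝓝 x]
      fun y ↦ mvfderiv 𝓘(ℝ, E) (localMap F ψ x) y (ext v y) := by
    filter_upwards [(hψ x).continuousAt.eventually (eventually_mem_triv (E := F) (ψ x))] with y hy
    exact triv_mfderiv (hψ y) hy _
  rw [hessMap, pullbackNabla, secondForm_apply, hessian, LinearMap.mk₂_apply, mvfderiv_congr e,
    map_sub, symmL_mvfderiv_localMap (hψ x), christoffel_apply, christoffel_apply, ext_self]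
  abel

/-- The derivative of `dψ ∘ φ = J ∘ dψ`. -/
lemma secondForm_phi {φ : EndField E M} (hφ : SmoothEnd φ) {J : EndField F N} (hJ : IsKaehler J)
    {ψ : M → N} (h : IsHolomorphicSubmersion φ J ψ) {x : M} (u v : TangentSpace 𝓘(ℝ, E) x) :
    secondForm (h.smooth x) u (φ x v) + mfderiv 𝓘(ℝ, E) 𝓘(ℝ, F) ψ x (covEnd φ u v) =
      J (ψ x) (secondForm (h.smooth x) u v) := by
  have hf := localMap_contMDiffAt (h.smooth x)
  -- Holomorphy near `x`, read in the chart at `ψ x`: both sides take values in the fixed space `F`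
  -- and can be differentiated along `u`.
  have e : (fun y ↦ mvfderiv 𝓘(ℝ, E) (localMap F ψ x) y (app φ (ext v) y)) =ᶠ[𝓝 x]
      fun y ↦ (triv F (ψ x)).continuousLinearMapAt ℝ (ψ y) (J (ψ y)
        ((triv F (ψ x)).symmL ℝ (ψ y) (mvfderiv 𝓘(ℝ, E) (localMap F ψ x) y (ext v y)))) := by
    filter_upwards [(h.smooth x).continuousAt.eventually
      (eventually_mem_triv (E := F) (ψ x))] with y hy
    rw [← triv_mfderiv (h.smooth y) hy, ← triv_mfderiv (h.smooth y) hy,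
      Trivialization.symmL_continuousLinearMapAt _ hy, app, h.holomorphic]
  have e1 := leibniz_along ((h.smooth x).mdifferentiableAt (by simp))
    (fun z ↦ ((triv F (ψ x)).continuousLinearMapAt ℝ z).toLinearMap ∘ₗ (J z).toLinearMap)
    (fun u ↦ rep_mdiff (hJ.smooth_J.app (smooth_ext u))) (mdiff_mvfderiv_ext hf v) u
  have e2 := (congrArg (fun A ↦ A u) (mvfderiv_congr e)).trans e1
  rw [mvfderiv_mvfderiv hf (hφ.app (smooth_ext v)), nabla_app hφ (smooth_ext v)] at e2
  have e3 := congrArg ((triv F (ψ x)).symmL ℝ (ψ x)) e2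
  -- `∇J = 0` on a coordinate field: the coordinate derivative of `J` is its commutator with the
  -- Christoffel symbols.
  have hJ0 := hJ.parallel (ψ x) (mfderiv 𝓘(ℝ, E) 𝓘(ℝ, F) ψ x u)
    (ext (mfderiv 𝓘(ℝ, E) 𝓘(ℝ, F) ψ x v)) (smooth_ext _)
  rw [nabla_eq (hJ.smooth_J.app (smooth_ext _)), ← christoffel_apply] at hJ0
  simp only [app, ext_self] at hJ0
  have e4 : (triv F (ψ x)).symmL ℝ (ψ x) (mvfderiv 𝓘(ℝ, E)
      (fun y ↦ mvfderiv 𝓘(ℝ, E) (localMap F ψ x) y (ext v y)) x u) =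
      (triv F (ψ x)).symmL ℝ (ψ x) (hessian hf u v) +
        mfderiv 𝓘(ℝ, E) 𝓘(ℝ, F) ψ x (christoffel x u v) := by
    rw [← symmL_mvfderiv_localMap (h.smooth x), ← map_add, hessian, LinearMap.mk₂_apply,
      sub_add_cancel]
  have e5 : (triv F (ψ x)).symmL ℝ (ψ x) (mvfderiv 𝓘(ℝ, E) (localMap F ψ x) x (ext v x)) =
      mfderiv 𝓘(ℝ, E) 𝓘(ℝ, F) ψ x v := by
    rw [ext_self]; exact symmL_mvfderiv_localMap (h.smooth x) v
  rw [e4, e5] at e3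
  have e6 : (triv F (ψ x)).symmL ℝ (ψ x) (mvfderiv 𝓘(ℝ, F) (rep (ψ x) (app J
      (ext (mfderiv 𝓘(ℝ, E) 𝓘(ℝ, F) ψ x v)))) (ψ x) (mfderiv 𝓘(ℝ, E) 𝓘(ℝ, F) ψ x u)) =
      J (ψ x) (christoffel (ψ x) (mfderiv 𝓘(ℝ, E) 𝓘(ℝ, F) ψ x u)
        (mfderiv 𝓘(ℝ, E) 𝓘(ℝ, F) ψ x v)) - christoffel (ψ x) (mfderiv 𝓘(ℝ, E) 𝓘(ℝ, F) ψ x u)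
        (J (ψ x) (mfderiv 𝓘(ℝ, E) 𝓘(ℝ, F) ψ x v)) := eq_sub_of_add_eq hJ0
  have e7 : ∀ w, (triv F (ψ x)).symmL ℝ (ψ x) ((triv F (ψ x)).continuousLinearMapAt ℝ (ψ x)
      (J (ψ x) w)) = J (ψ x) w := fun w ↦ Trivialization.symmL_continuousLinearMapAt _ (mem_triv _) _
  have e8 := (e3.trans (map_add _ _ _)).trans (congrArg₂ (· + ·) e6 (e7 _))
  simp only [app, ext_self, ← christoffel_apply, map_add, symmL_mvfderiv_localMap (h.smooth x),
    h.holomorphic] at e8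
  rw [secondForm_apply, secondForm_apply, h.holomorphic, map_add]
  have e9 := sub_eq_zero.2 e8
  refine sub_eq_zero.1 (Eq.trans ?_ e9)
  abel

end Maps

/-! ### The trace argument -/

section Trace

variable {V : Type*} [NormedAddCommGroup V] [InnerProductSpace ℝ V]
  {W : Type*} [AddCommGroup W] [Module ℝ W]

/-- The trace of a bilinear map `B` satisfying `B(u,φv) = J B(u,v) + η(v) T u`. -/
lemma trace_eq_zero {ι : Type*} [Fintype ι] (b : OrthonormalBasis ι ℝ V)
    (φ : V →ₗ[ℝ] V) (ξ : V) (J : W →ₗ[ℝ] W) (T : V →ₗ[ℝ] W) (B : V →ₗ[ℝ] V →ₗ[ℝ] W)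
    (hJ : ∀ w, J (J w) = -w) (hB : ∀ u v, B u v = B v u)
    (hBφ : ∀ u v, B u (φ v) = J (B u v) + ⟪ξ, v⟫_ℝ • T u)
    (hTφ : ∀ v, T (φ v) = J (T v)) (hTξ : T ξ = 0) (hφξ : φ ξ = 0)
    (hφ : ∀ u v, ⟪φ u, v⟫_ℝ = -⟪u, φ v⟫_ℝ)
    (hc : ∀ u v, ⟪φ u, φ v⟫_ℝ = ⟪u, v⟫_ℝ - ⟪ξ, u⟫_ℝ * ⟪ξ, v⟫_ℝ) :
    ∑ i, B (b i) (b i) = 0 := by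
  have h1 : ∀ u, B (φ u) (φ u) = -B u u + (2 * ⟪ξ, u⟫_ℝ) • J (T u) := fun u ↦ by
    rw [hBφ, hB, hBφ, hTφ, map_add, hJ, map_smul, two_mul, add_smul, add_assoc]
  have h2 : B ξ ξ = 0 := by
    have := hBφ ξ ξ
    rw [hφξ, map_zero, hTξ, smul_zero, add_zero] at this
    have h3 := hJ (B ξ ξ)
    rw [← this, map_zero] at h3
    simpa using h3.symm
  -- Since `φ` is skew with `-φ² = 1 - ξ ⊗ ξ`, passing to the `φ`-image of the basis alters the
  -- trace only by `B(ξ,ξ)`, which is zero.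
  have h3 : ∑ i, B (φ (b i)) (φ (b i)) = ∑ i, B (b i) (b i) := by
    have e1 : ∀ i, B (φ (b i)) (φ (b i)) =
        ∑ k, ∑ l, (⟪φ (b k), b i⟫_ℝ * ⟪b i, φ (b l)⟫_ℝ) • B (b k) (b l) := fun i ↦ by
      conv_lhs => rw [← b.sum_repr' (φ (b i))]
      simp only [map_sum, map_smul, LinearMap.sum_apply, LinearMap.smul_apply, Finset.smul_sum,
        smul_smul]
      refine Finset.sum_comm.trans ?_
      refine Finset.sum_congr rfl fun k _ ↦ Finset.sum_congr rfl fun l _ ↦ ?_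
      rw [hφ, real_inner_comm, hφ]
      congr 1; ring
    simp only [e1]
    rw [Finset.sum_comm]
    simp only [fun k ↦ Finset.sum_comm (s := Finset.univ) (t := Finset.univ)
      (f := fun i l ↦ (⟪φ (b k), b i⟫_ℝ * ⟪b i, φ (b l)⟫_ℝ) • B (b k) (b l)), ← Finset.sum_smul,
      b.sum_inner_mul_inner, hc, sub_smul, Finset.sum_sub_distrib]
    have e2 : ∑ k, ∑ l, (⟪ξ, b k⟫_ℝ * ⟪ξ, b l⟫_ℝ) • B (b k) (b l) = 0 := by
      rw [← h2]
      conv_rhs => rw [← b.sum_repr' ξ]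
      simp only [map_sum, map_smul, LinearMap.sum_apply, LinearMap.smul_apply, Finset.smul_sum,
        smul_smul]
      rw [Finset.sum_comm]
      refine Finset.sum_congr rfl fun k _ ↦ Finset.sum_congr rfl fun l _ ↦ ?_
      rw [mul_comm, real_inner_comm (b k), real_inner_comm (b l)]
    rw [e2, sub_zero]
    classical
    refine Finset.sum_congr rfl fun k _ ↦ ?_
    simp [orthonormal_iff_ite.1 b.orthonormal]
  -- By linearity the sum collapses to `2 J (T ξ)`.
  have h4 : ∑ i, (2 * ⟪ξ, b i⟫_ℝ) • J (T (b i)) = 0 := by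
    have : ∑ i, ⟪b i, ξ⟫_ℝ • J (T (b i)) = 0 := by
      rw [← map_zero J, ← hTξ]
      conv_rhs => rw [← b.sum_repr' ξ]
      simp only [map_sum, map_smul]
    simp only [real_inner_comm ξ] at this
    simp only [mul_smul, ← Finset.smul_sum, this, smul_zero]
  simp only [h1, Finset.sum_add_distrib, h4, Finset.sum_neg_distrib, add_zero] at h3
  have h5 : (2 : ℝ) • ∑ i, B (b i) (b i) = 0 := by
    rw [two_smul]
    nth_rewrite 1 [← h3]
    exact neg_add_cancel _
  exact (smul_eq_zero_iff_right two_ne_zero).1 h5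

end Trace

/-! ### Horizontal geometry and harmonicity of holomorphic submersions -/

section Submersion

variable {E : Type*} [NormedAddCommGroup E] [NormedSpace ℝ E] [FiniteDimensional ℝ E]
  {M : Type*} [TopologicalSpace M] [ChartedSpace E M] [IsManifold 𝓘(ℝ, E) ∞ M]
  {F : Type*} [NormedAddCommGroup F] [NormedSpace ℝ F] [FiniteDimensional ℝ F]
  {N : Type*} [TopologicalSpace N] [ChartedSpace F N] [IsManifold 𝓘(ℝ, F) ∞ N]
  [RiemannianBundle (fun x : M ↦ TangentSpace 𝓘(ℝ, E) x)]
  [RiemannianBundle (fun y : N ↦ TangentSpace 𝓘(ℝ, F) y)]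
  {φ : EndField E M} {ξ : VF E M} {η : OneForm E M} {J : EndField F N} {ψ : M → N}

namespace IsHolomorphicSubmersion

lemma mfderiv_xi (h : IsHolomorphicSubmersion φ J ψ) (hM : IsAlmostContactMetric φ ξ η)
    (hN : IsKaehler J) (x : M) : mfderiv 𝓘(ℝ, E) 𝓘(ℝ, F) ψ x (ξ x) = 0 := by
  have h1 := h.holomorphic x (ξ x)
  rw [hM.phi_xi, map_zero] at h1
  have h2 := hN.J_J (ψ x) (mfderiv 𝓘(ℝ, E) 𝓘(ℝ, F) ψ x (ξ x))
  rw [← h1, map_zero] at h2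
  exact neg_eq_zero.1 h2.symm

lemma xi_mem_vertical (h : IsHolomorphicSubmersion φ J ψ) (hM : IsAlmostContactMetric φ ξ η)
    (hN : IsKaehler J) (x : M) : ξ x ∈ vertical E F ψ x :=
  h.mfderiv_xi hM hN x

lemma phi_mem_vertical (h : IsHolomorphicSubmersion φ J ψ) {x : M}
    {v : TangentSpace 𝓘(ℝ, E) x} (hv : v ∈ vertical E F ψ x) : φ x v ∈ vertical E F ψ x := by
  have hv' : mfderiv 𝓘(ℝ, E) 𝓘(ℝ, F) ψ x v = 0 := hv
  refine LinearMap.mem_ker.2 ?_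
  exact (h.holomorphic x v).trans (by rw [hv', map_zero])

lemma phi_mem_horizontal (h : IsHolomorphicSubmersion φ J ψ) (hM : IsAlmostContactMetric φ ξ η)
    {x : M} {v : TangentSpace 𝓘(ℝ, E) x} (hv : v ∈ horizontal E F ψ x) :
    φ x v ∈ horizontal E F ψ x := by
  refine (Submodule.mem_orthogonal _ _).2 fun u hu ↦ ?_
  have := (Submodule.mem_orthogonal _ _).1 hv _ (h.phi_mem_vertical hu)
  rw [hM.inner_phi] at this
  linarith

lemma eta_eq_zero (h : IsHolomorphicSubmersion φ J ψ) (hM : IsAlmostContactMetric φ ξ η)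
    (hN : IsKaehler J) {x : M} {v : TangentSpace 𝓘(ℝ, E) x} (hv : v ∈ horizontal E F ψ x) :
    η x v = 0 := by
  rw [hM.eta_eq]
  exact (Submodule.mem_orthogonal _ _).1 hv _ (h.xi_mem_vertical hM hN x)

/-- Both sides are horizontal and have the same image under `dψ`, which is injective on `H`. -/
lemma horJ_eq (h : IsHolomorphicSubmersion φ J ψ) (hM : IsAlmostContactMetric φ ξ η)
    {x : M} {v : TangentSpace 𝓘(ℝ, E) x} (hv : v ∈ horizontal E F ψ x) :
    horJ J ψ x v = φ x v := by
  have h1 : ∃ a ∈ (horizontal E F ψ x : Set (TangentSpace 𝓘(ℝ, E) x)),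
      mfderiv 𝓘(ℝ, E) 𝓘(ℝ, F) ψ x a = J (ψ x) (mfderiv 𝓘(ℝ, E) 𝓘(ℝ, F) ψ x v) :=
    ⟨φ x v, h.phi_mem_horizontal hM hv, h.holomorphic x v⟩
  have h2 : horJ J ψ x v ∈ horizontal E F ψ x := Function.invFunOn_mem h1
  have h3 : mfderiv 𝓘(ℝ, E) 𝓘(ℝ, F) ψ x (horJ J ψ x v) = _ := Function.invFunOn_eq h1
  have h4 : horJ J ψ x v - φ x v ∈ vertical E F ψ x := by
    refine LinearMap.mem_ker.2 ?_
    exact (map_sub (mfderiv 𝓘(ℝ, E) 𝓘(ℝ, F) ψ x) _ _).trans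
      (sub_eq_zero.2 (h3.trans (h.holomorphic x v).symm))
  have h5 : horJ J ψ x v - φ x v ∈ horizontal E F ψ x :=
    sub_mem h2 (h.phi_mem_horizontal hM hv)
  exact sub_eq_zero.1 ((Submodule.disjoint_def.1 (Submodule.orthogonal_disjoint _)) _ h4 h5)

lemma isPHWC (h : IsHolomorphicSubmersion φ J ψ) (hM : IsAlmostContactMetric φ ξ η)
    (hN : IsKaehler J) : IsPHWC (E := E) J ψ := fun x u hu v hv ↦ by
  rw [h.horJ_eq hM hu, h.horJ_eq hM hv, hM.compatible, h.eta_eq_zero hM hN hu]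
  simp

variable [IsContMDiffRiemannianBundle 𝓘(ℝ, E) ∞ E (fun x : M ↦ TangentSpace 𝓘(ℝ, E) x)]

/-- On `H` the Sasaki identity reads `(∇_v φ) Y = g(v,Y) ξ`, which is vertical. The horizontal
projection commutes with `φ` because `φ` preserves both summands. -/
lemma isPHH {m : ℕ} (h : IsHolomorphicSubmersion φ J ψ) (hM : IsSasaki m φ ξ η)
    (hN : IsKaehler J) : IsPHH (E := E) J ψ := by
  have hM' := hM.toIsContactMetric.toIsAlmostContactMetric
  refine ⟨h.isPHWC hM' hN, fun x v hv Y hY hYH ↦ ?_⟩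
  have e1 : (fun y ↦ horJ J ψ y (Y y)) =ᶠ[𝓝 x] app φ Y := by
    filter_upwards [hYH] with y hy using h.horJ_eq hM' hy
  have e2 : (horizontal E F ψ x)ᗮ = vertical E F ψ x := Submodule.orthogonal_orthogonal _
  have e3 : ∀ z ∈ vertical E F ψ x, (horizontal E F ψ x).starProjection z = 0 := fun z hz ↦
    (Submodule.starProjection_apply_eq_zero_iff _).2 (by rwa [e2])
  have e4 : ∀ z : TangentSpace 𝓘(ℝ, E) x, (horizontal E F ψ x).starProjection (φ x z) =
      φ x ((horizontal E F ψ x).starProjection z) := fun z ↦ by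
    have hz : z = (horizontal E F ψ x).starProjection z +
        (z - (horizontal E F ψ x).starProjection z) := by abel
    have hz1 : (z - (horizontal E F ψ x).starProjection z) ∈ vertical E F ψ x := by
      rw [← e2]; exact Submodule.sub_starProjection_mem_orthogonal z
    conv_lhs => rw [hz, map_add, map_add, e3 _ (h.phi_mem_vertical hz1), add_zero]
    exact Submodule.starProjection_eq_self_iff.2
      (h.phi_mem_horizontal hM' (Submodule.starProjection_apply_mem _ _))
  rw [nabla_congr (hM.smooth_phi.app hY) e1, nabla_app hM.smooth_phi hY, hM.covEnd_phi,
    h.eta_eq_zero hM' hN hYH.self_of_nhds, zero_smul, sub_zero, map_add, map_smul,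
    e3 _ (h.xi_mem_vertical hM' hN x), smul_zero, zero_add, e4,
    h.horJ_eq hM' (Submodule.starProjection_apply_mem _ _)]

variable [IsContMDiffRiemannianBundle 𝓘(ℝ, F) ∞ F (fun x : N ↦ TangentSpace 𝓘(ℝ, F) x)]

/-- Since `dψ ξ = 0`, the term `dψ ((∇_u φ) v)` of `secondForm_phi` is `-η(v) dψ u`; this is the
hypothesis of `trace_eq_zero` with `T = dψ`. -/
lemma isHarmonicMap {m : ℕ} (h : IsHolomorphicSubmersion φ J ψ) (hM : IsSasaki m φ ξ η)
    (hN : IsKaehler J) : IsHarmonicMap E F ψ := by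
  have hM' := hM.toIsContactMetric.toIsAlmostContactMetric
  refine ⟨h.smooth, fun x ↦ ?_⟩
  simp only [tension, hessMap_eq h.smooth]
  refine trace_eq_zero (stdOrthonormalBasis ℝ (TangentSpace 𝓘(ℝ, E) x)) (φ x).toLinearMap (ξ x)
    (J (ψ x)).toLinearMap (mfderiv 𝓘(ℝ, E) 𝓘(ℝ, F) ψ x).toLinearMap (secondForm (h.smooth x))
    (hN.J_J _) (secondForm_comm _) (fun u v ↦ ?_) (h.holomorphic x) (h.mfderiv_xi hM' hN x)
    (hM'.phi_xi x) (hM'.inner_phi x) (fun u v ↦ ?_)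
  · have := secondForm_phi hM.smooth_phi hN h u v
    rw [hM.covEnd_phi, map_sub, map_smul, map_smul, h.mfderiv_xi hM' hN x, smul_zero, zero_sub,
      hM'.eta_eq] at this
    exact add_neg_eq_iff_eq_add.1 this
  · rw [← hM'.eta_eq, ← hM'.eta_eq]; exact hM'.compatible x u v

end IsHolomorphicSubmersion

end Submersion

/-! ### Tangent spaces of submanifolds -/

section Submanifold

variable {E : Type*} [NormedAddCommGroup E] [NormedSpace ℝ E] [FiniteDimensional ℝ E]
  {M : Type*} [TopologicalSpace M] [ChartedSpace E M] [IsManifold 𝓘(ℝ, E) ∞ M]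
  {W : Type*} [NormedAddCommGroup W] [NormedSpace ℝ W]

lemma contMDiffAt_mvfderiv_apply {x : M} {f : M → W} (hf : ContMDiffAt 𝓘(ℝ, E) 𝓘(ℝ, W) ∞ f x)
    {Y : VF E M} (hY : SmoothVFAt Y x) :
    ContMDiffAt 𝓘(ℝ, E) 𝓘(ℝ, W) ∞ (fun y ↦ mvfderiv 𝓘(ℝ, E) f y (Y y)) x := by
  have h1 : ContMDiffAt 𝓘(ℝ, E) 𝓘(ℝ, E →L[ℝ] W) ∞
      (fun y ↦ fderiv ℝ (f ∘ (extChartAt 𝓘(ℝ, E) x).symm) (extChartAt 𝓘(ℝ, E) x y)) x :=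
    ((contDiffAt_comp_extChartAt_symm hf).fderiv_right (m := ∞) (by simp)).contMDiffAt.comp x
      contMDiffAt_extChartAt
  refine (h1.clm_apply (rep_contMDiffAt hY (mem_triv x))).congr_of_eventuallyEq ?_
  filter_upwards [eventually_mem_triv (E := E) x, contMDiffAt_eventually_mdiff hf] with y hy h
  have h2 := mvfderiv_ext hy h ((triv E x).symmL ℝ x (rep x Y y))
  rwa [ext_eq _ hy, Trivialization.continuousLinearMapAt_symmL _ (mem_triv x),
    symmL_rep Y hy] at h2

lemma hasStrictFDerivAt_comp_extChartAt_symm {x : M} {g : M → W}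
    (hg : ContMDiffAt 𝓘(ℝ, E) 𝓘(ℝ, W) 1 g x) :
    HasStrictFDerivAt (g ∘ (extChartAt 𝓘(ℝ, E) x).symm)
      (fderiv ℝ (g ∘ (extChartAt 𝓘(ℝ, E) x).symm) (extChartAt 𝓘(ℝ, E) x x))
      (extChartAt 𝓘(ℝ, E) x x) := by
  have := (contMDiffAt_iff.1 hg).2
  rw [modelWithCornersSelf_coe, range_id, contDiffWithinAt_univ,
    extChartAt_model_space_eq_id] at this
  exact ContDiffAt.hasStrictFDerivAt this (by simp)

lemma mvfderiv_eq_fderiv_extChartAt_symm {x : M} {g : M → W}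
    (hg : MDifferentiableAt 𝓘(ℝ, E) 𝓘(ℝ, W) g x) (v : TangentSpace 𝓘(ℝ, E) x) :
    mvfderiv 𝓘(ℝ, E) g x v =
      fderiv ℝ (g ∘ (extChartAt 𝓘(ℝ, E) x).symm) (extChartAt 𝓘(ℝ, E) x x)
        ((triv E x).continuousLinearMapAt ℝ x v) := by
  have := mvfderiv_ext (mem_triv x) hg v
  rwa [ext_self] at this

/-- Lagrange multipliers: a function vanishing on a level set of a submersion has
differential vanishing on the kernel of the differential of the submersion. -/
lemma mvfderiv_eq_zero_of_levelSet [CompleteSpace W] {x : M} {f : M → ℝ} {F : M → W}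
    (hf : ContMDiffAt 𝓘(ℝ, E) 𝓘(ℝ, ℝ) 1 f x) (hF : ContMDiffAt 𝓘(ℝ, E) 𝓘(ℝ, W) 1 F x)
    (hF' : Function.Surjective (mvfderiv 𝓘(ℝ, E) F x))
    (h : ∀ᶠ y in 𝓝 x, F y = F x → f y = f x) {v : TangentSpace 𝓘(ℝ, E) x}
    (hv : mvfderiv 𝓘(ℝ, E) F x v = 0) : mvfderiv 𝓘(ℝ, E) f x v = 0 := by
  have h4 : Tendsto (extChartAt 𝓘(ℝ, E) x).symm (𝓝 (extChartAt 𝓘(ℝ, E) x x)) (𝓝 x) := by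
    have := continuousAt_extChartAt_symm (I := 𝓘(ℝ, E)) x
    rwa [ContinuousAt, extChartAt_to_inv] at this
  have hext : IsLocalExtrOn (f ∘ (extChartAt 𝓘(ℝ, E) x).symm)
      {z | (F ∘ (extChartAt 𝓘(ℝ, E) x).symm) z =
        (F ∘ (extChartAt 𝓘(ℝ, E) x).symm) (extChartAt 𝓘(ℝ, E) x x)}
      (extChartAt 𝓘(ℝ, E) x x) := by
    -- A function constant on the constraint set has a trivial minimum there.
    refine Or.inl (eventually_nhdsWithin_iff.2 ?_)
    filter_upwards [h4.eventually h] with z hz hz2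
    simp only [Function.comp_apply, extChartAt_to_inv] at hz2 ⊢
    exact (hz hz2).ge
  obtain ⟨Λ, c, hΛ, h0⟩ := hext.exists_linear_map_of_hasStrictFDerivAt 
    (hasStrictFDerivAt_comp_extChartAt_symm hF) (hasStrictFDerivAt_comp_extChartAt_symm hf)
  have h1 : ∀ v, Λ (mvfderiv 𝓘(ℝ, E) F x v) + c • mvfderiv 𝓘(ℝ, E) f x v = 0 := fun v ↦ by
    rw [mvfderiv_eq_fderiv_extChartAt_symm (hF.mdifferentiableAt (by simp)),
      mvfderiv_eq_fderiv_extChartAt_symm (hf.mdifferentiableAt (by simp))]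
    exact h0 _
  -- If `c = 0`, then `Λ` vanishes on the range of `dF`, which is everything, and the multiplier
  -- would be trivial.
  have hc : c ≠ 0 := by
    rintro rfl
    refine hΛ (Prod.ext (LinearMap.ext fun w ↦ ?_) rfl)
    obtain ⟨v, rfl⟩ := hF' w
    simpa using h1 v
  have := h1 v
  rw [hv, map_zero, zero_add] at this
  exact (smul_eq_zero.1 this).resolve_left hc

variable {S : Set M} {d : ℕ}

/-- The tangent space of a submanifold is the kernel of the differential of a defining map. -/
lemma mem_tangentSub_iff {c : ℕ} {x : M} (hx : x ∈ S) {U : Set M} (hU : IsOpen U) (hxU : x ∈ U)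
    {F : M → EuclideanSpace ℝ (Fin c)}
    (hF : ContMDiffOn 𝓘(ℝ, E) 𝓘(ℝ, EuclideanSpace ℝ (Fin c)) ∞ F U)
    (hF' : Function.Surjective (mfderiv 𝓘(ℝ, E) 𝓘(ℝ, EuclideanSpace ℝ (Fin c)) F x))
    (hFS : ∀ y ∈ U, y ∈ S ↔ F y = 0) (v : TangentSpace 𝓘(ℝ, E) x) :
    v ∈ tangentSub S x ↔ mvfderiv 𝓘(ℝ, E) F x v = 0 := by
  have hFx : ContMDiffAt 𝓘(ℝ, E) 𝓘(ℝ, EuclideanSpace ℝ (Fin c)) ∞ F x :=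
    hF.contMDiffAt (hU.mem_nhds hxU)
  constructor
  · intro hv
    simp only [tangentSub, Submodule.mem_iInf] at hv
    ext i
    -- The components of `F` are themselves among the test functions defining the tangent space.
    have hp := mvfderiv_clm_comp (EuclideanSpace.proj i : EuclideanSpace ℝ (Fin c) →L[ℝ] ℝ)
      (hFx.mdifferentiableAt (by simp))
    have hs : ContMDiffAt 𝓘(ℝ, E) 𝓘(ℝ, ℝ) ∞
        (fun y ↦ (EuclideanSpace.proj i : EuclideanSpace ℝ (Fin c) →L[ℝ] ℝ) (F y)) x :=
      (EuclideanSpace.proj i : EuclideanSpace ℝ (Fin c) →L[ℝ] ℝ).contDiff.contMDiff.contMDiffAt.comp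
        x hFx
    have h2 := LinearMap.mem_ker.1 (hv ⟨_, hs, by
      filter_upwards [self_mem_nhdsWithin, mem_nhdsWithin_of_mem_nhds (hU.mem_nhds hxU)] with y h1 h2
      rw [(hFS y h2).1 h1, map_zero]⟩)
    exact (hp.2 v).symm.trans h2
  · intro hv
    simp only [tangentSub, Submodule.mem_iInf]
    rintro ⟨f, hf, hf0⟩
    refine LinearMap.mem_ker.2 (mvfderiv_eq_zero_of_levelSet (hf.of_le (by simp))
      (hFx.of_le (by simp)) hF' ?_ hv)
    have hx0 := hf0.self_of_nhdsWithin hx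
    filter_upwards [hU.mem_nhds hxU, eventually_nhdsWithin_iff.1 hf0] with y h1 h2 h3
    rw [hx0]
    exact h2 ((hFS y h1).2 (h3.trans ((hFS x hxU).1 hx)))

/-- The definition tests only functions smooth to infinite order at the point. The `C¹` version is
needed because smoothness to infinite order at `x` gives only finite-order regularity at nearby
points. -/
lemma IsSubmanifold.mvfderiv_eq_zero (hS : IsSubmanifold (E := E) S d) {x : M} (hx : x ∈ S)
    {f : M → ℝ} (hf : ContMDiffAt 𝓘(ℝ, E) 𝓘(ℝ, ℝ) 1 f x) (hf0 : ∀ᶠ y in 𝓝[S] x, f y = 0)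
    {v : TangentSpace 𝓘(ℝ, E) x} (hv : v ∈ tangentSub S x) : mvfderiv 𝓘(ℝ, E) f x v = 0 := by
  obtain ⟨c, -, U, hU, hxU, F, hF, hF', hFS⟩ := hS x hx
  have hv' := (mem_tangentSub_iff hx hU hxU hF (hF' x hxU) hFS v).1 hv
  refine mvfderiv_eq_zero_of_levelSet hf
      ((hF.contMDiffAt (hU.mem_nhds hxU)).of_le (by simp)) (hF' x hxU) ?_ hv'
  have hx0 := hf0.self_of_nhdsWithin hx
  filter_upwards [hU.mem_nhds hxU, eventually_nhdsWithin_iff.1 hf0] with y h1 h2 h3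
  rw [hx0]
  exact h2 ((hFS y h1).2 (h3.trans ((hFS x hxU).1 hx)))

lemma IsSubmanifold.finrank_tangentSub (hS : IsSubmanifold (E := E) S d) {x : M} (hx : x ∈ S) :
    Module.finrank ℝ (tangentSub (E := E) S x) = d := by
  obtain ⟨c, hc, U, hU, hxU, F, hF, hF', hFS⟩ := hS x hx
  have h1 : tangentSub S x = LinearMap.ker (mvfderiv 𝓘(ℝ, E) F x).toLinearMap := by
    ext v
    exact mem_tangentSub_iff hx hU hxU hF (hF' x hxU) hFS v
  have h2 := LinearMap.finrank_range_add_finrank_ker (mvfderiv 𝓘(ℝ, E) F x).toLinearMap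
  have h3 : Module.finrank ℝ (TangentSpace 𝓘(ℝ, E) x) = Module.finrank ℝ E := rfl
  have h4 : LinearMap.range (mvfderiv 𝓘(ℝ, E) F x).toLinearMap = ⊤ :=
    LinearMap.range_eq_top.2 (hF' x hxU)
  rw [h4, finrank_top, h3, finrank_euclideanSpace_fin] at h2
  rw [h1]
  omega

/-- Differentiating `df(Y) = 0` along the submanifold. -/
lemma IsSubmanifold.hessian_add_eq_zero
    [RiemannianBundle (fun x : M ↦ TangentSpace 𝓘(ℝ, E) x)]
    [IsContMDiffRiemannianBundle 𝓘(ℝ, E) ∞ E (fun x : M ↦ TangentSpace 𝓘(ℝ, E) x)]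
    (hS : IsSubmanifold (E := E) S d) {x : M} (hx : x ∈ S)
    {f : M → ℝ} (hf : ContMDiffAt 𝓘(ℝ, E) 𝓘(ℝ, ℝ) ∞ f x) (hf0 : ∀ᶠ y in 𝓝[S] x, f y = 0)
    {v : TangentSpace 𝓘(ℝ, E) x} (hv : v ∈ tangentSub S x) {Y : VF E M} (hY : SmoothVFAt Y x)
    (hYS : ∀ᶠ y in 𝓝[S] x, Y y ∈ tangentSub S y) :
    hessian hf v (Y x) + mvfderiv 𝓘(ℝ, E) f x (nabla v Y) = 0 := by
  rw [← mvfderiv_mvfderiv hf hY v]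
  refine hS.mvfderiv_eq_zero hx ((contMDiffAt_mvfderiv_apply hf hY).of_le (by simp)) ?_ hv
  have h1 : ContMDiffAt 𝓘(ℝ, E) 𝓘(ℝ, ℝ) 1 f x := hf.of_le (by simp)
  have h2 := (contMDiffAt_iff_contMDiffAt_nhds (by simp)).1 h1
  filter_upwards [hYS, eventually_eventually_nhdsWithin.2 hf0, self_mem_nhdsWithin,
    mem_nhdsWithin_of_mem_nhds h2] with y e1 e2 e3 e4
  exact hS.mvfderiv_eq_zero e3 e4 e2 e1

end Submanifold

/-! ### Preimages of submanifolds under submersions, and points -/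

section Preimage

variable {E : Type*} [NormedAddCommGroup E] [NormedSpace ℝ E] [FiniteDimensional ℝ E]
  {M : Type*} [TopologicalSpace M] [ChartedSpace E M] [IsManifold 𝓘(ℝ, E) ∞ M]
  {F : Type*} [NormedAddCommGroup F] [NormedSpace ℝ F] [FiniteDimensional ℝ F]
  {N : Type*} [TopologicalSpace N] [ChartedSpace F N] [IsManifold 𝓘(ℝ, F) ∞ N]

lemma mfderiv_comp_surjective {c : ℕ} {ψ : M → N} {G : N → EuclideanSpace ℝ (Fin c)} {x : M}
    (hψ : MDifferentiableAt 𝓘(ℝ, E) 𝓘(ℝ, F) ψ x)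
    (hψ' : Function.Surjective (mfderiv 𝓘(ℝ, E) 𝓘(ℝ, F) ψ x))
    (hG : MDifferentiableAt 𝓘(ℝ, F) 𝓘(ℝ, EuclideanSpace ℝ (Fin c)) G (ψ x))
    (hG' : Function.Surjective (mfderiv 𝓘(ℝ, F) 𝓘(ℝ, EuclideanSpace ℝ (Fin c)) G (ψ x))) :
    Function.Surjective (mfderiv 𝓘(ℝ, E) 𝓘(ℝ, EuclideanSpace ℝ (Fin c)) (G ∘ ψ) x) := fun w ↦ by
  obtain ⟨u, rfl⟩ := hG' w
  obtain ⟨v, rfl⟩ := hψ' u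
  exact ⟨v, mfderiv_comp_apply x hG hψ v⟩

/-- Preimages of submanifolds under submersions are submanifolds of the same codimension. -/
lemma IsSubmanifold.preimage {K : Set N} {d d' : ℕ} (hK : IsSubmanifold (E := F) K d) {ψ : M → N}
    (hψ : ContMDiff 𝓘(ℝ, E) 𝓘(ℝ, F) ∞ ψ)
    (hψ' : ∀ x, Function.Surjective (mfderiv 𝓘(ℝ, E) 𝓘(ℝ, F) ψ x))
    (hd : d' + Module.finrank ℝ F = d + Module.finrank ℝ E) :
    IsSubmanifold (E := E) (ψ ⁻¹' K) d' := by
  intro x hx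
  obtain ⟨c, hc, U, hU, hxU, G, hG, hG', hGS⟩ := hK (ψ x) hx
  refine ⟨c, by omega, ψ ⁻¹' U, hU.preimage hψ.continuous, hxU, G ∘ ψ,
    hG.comp hψ.contMDiffOn Subset.rfl, fun y hy ↦ ?_, fun y hy ↦ hGS (ψ y) hy⟩
  exact mfderiv_comp_surjective ((hψ y).mdifferentiableAt (by simp)) (hψ' y)
    ((hG.contMDiffAt (hU.mem_nhds hy)).mdifferentiableAt (by simp)) (hG' (ψ y) hy)

/-- If `G` defines `K` locally, then `G ∘ ψ` defines the preimage, and the kernels of their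
differentials correspond by the chain rule. -/
lemma IsSubmanifold.mem_tangentSub_preimage {K : Set N} {d : ℕ} (hK : IsSubmanifold (E := F) K d)
    {ψ : M → N} (hψ : ContMDiff 𝓘(ℝ, E) 𝓘(ℝ, F) ∞ ψ)
    (hψ' : ∀ x, Function.Surjective (mfderiv 𝓘(ℝ, E) 𝓘(ℝ, F) ψ x)) {x : M} (hx : ψ x ∈ K)
    (v : TangentSpace 𝓘(ℝ, E) x) :
    v ∈ tangentSub (ψ ⁻¹' K) x ↔ mfderiv 𝓘(ℝ, E) 𝓘(ℝ, F) ψ x v ∈ tangentSub K (ψ x) := by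
  obtain ⟨c, hc, U, hU, hxU, G, hG, hG', hGS⟩ := hK (ψ x) hx
  have hGx := (hG.contMDiffAt (hU.mem_nhds hxU)).mdifferentiableAt (n := ∞) (by simp)
  have hψx := (hψ x).mdifferentiableAt (n := ∞) (by simp)
  rw [mem_tangentSub_iff hx hU hxU hG (hG' _ hxU) hGS,
    mem_tangentSub_iff (S := ψ ⁻¹' K) hx (hU.preimage hψ.continuous) hxU
      (hG.comp hψ.contMDiffOn Subset.rfl)
      (mfderiv_comp_surjective hψx (hψ' x) hGx (hG' _ hxU)) (fun y hy ↦ hGS (ψ y) hy)]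
  exact (mfderiv_comp_apply x hGx hψx v : _ = _) ▸ Iff.rfl

/-- The centred chart is a local submersion vanishing only at the point. This lets fibers be treated
as preimages of complex submanifolds. -/
lemma isSubmanifold_singleton (y : N) : IsSubmanifold (E := F) {y} 0 := by
  intro x hx
  obtain rfl : x = y := hx
  let A : F ≃L[ℝ] EuclideanSpace ℝ (Fin (Module.finrank ℝ F)) := toEuclidean
  have hA : ContDiff ℝ ∞ fun w ↦ A (w - extChartAt 𝓘(ℝ, F) x x) :=
    A.contDiff.comp (contDiff_id.sub contDiff_const)
  refine ⟨_, zero_add _, (chartAt F x).source, (chartAt F x).open_source, mem_chart_source F x,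
    (fun w ↦ A (w - extChartAt 𝓘(ℝ, F) x x)) ∘ extChartAt 𝓘(ℝ, F) x, ?_, fun z hz ↦ ?_,
    fun z hz ↦ ?_⟩
  · exact hA.contMDiff.comp_contMDiffOn contMDiffOn_extChartAt
  · have hz' : z ∈ (extChartAt 𝓘(ℝ, F) x).source := by rwa [extChartAt_source]
    have h1 : MDifferentiableAt 𝓘(ℝ, F) 𝓘(ℝ, F) (extChartAt 𝓘(ℝ, F) x) z :=
      mdifferentiableAt_extChartAt hz
    refine mfderiv_comp_surjective h1 ?_ (hA.contMDiff.mdifferentiable (by simp) _) ?_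
    · obtain ⟨e, he⟩ := isInvertible_mfderiv_extChartAt (I := 𝓘(ℝ, F)) hz'
      rw [← he]
      exact e.surjective
    · have h2 : fderiv ℝ (fun w ↦ A (w - extChartAt 𝓘(ℝ, F) x x)) (extChartAt 𝓘(ℝ, F) x z) =
          (A : F →L[ℝ] _) := by
        have := A.toContinuousLinearMap.hasFDerivAt.comp (extChartAt 𝓘(ℝ, F) x z)
          ((hasFDerivAt_id (𝕜 := ℝ) _).sub_const (extChartAt 𝓘(ℝ, F) x x))
        exact this.fderiv
      rw [mfderiv_eq_fderiv, h2]
      exact A.surjective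
  · have hz' : z ∈ (extChartAt 𝓘(ℝ, F) x).source := by rwa [extChartAt_source]
    simp only [Function.comp_apply, map_eq_zero_iff A A.injective, sub_eq_zero]
    exact ⟨fun h ↦ by rw [mem_singleton_iff.1 h],
      fun h ↦ (extChartAt 𝓘(ℝ, F) x).injOn hz' (mem_extChartAt_source x) h⟩

lemma tangentSub_singleton (y : N) : tangentSub (E := F) {y} y = ⊥ :=
  Submodule.finrank_eq_zero.1 ((isSubmanifold_singleton y).finrank_tangentSub rfl)

end Preimage

/-! ### Minimality of invariant submanifolds -/

section Minimal

variable {E : Type*} [NormedAddCommGroup E] [NormedSpace ℝ E] [FiniteDimensional ℝ E]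
  {M : Type*} [TopologicalSpace M] [ChartedSpace E M] [IsManifold 𝓘(ℝ, E) ∞ M]
  [RiemannianBundle (fun x : M ↦ TangentSpace 𝓘(ℝ, E) x)]
  [IsContMDiffRiemannianBundle 𝓘(ℝ, E) ∞ E (fun x : M ↦ TangentSpace 𝓘(ℝ, E) x)]
  {φ : EndField E M} {ξ : VF E M} {η : OneForm E M}

/-- Invariant submanifolds of Sasaki manifolds tangent to the Reeb field are minimal. -/
theorem IsSasaki.isMinimalSubmanifold {m : ℕ} (hM : IsSasaki m φ ξ η) {S : Set M} {d : ℕ}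
    (hS : IsSubmanifold (E := E) S d) (hφ : IsInvariantSub φ S)
    (hξ : ∀ x ∈ S, ξ x ∈ tangentSub S x) : IsMinimalSubmanifold (E := E) S d := by
  refine ⟨hS, fun x hx e he heS hon ↦ ?_⟩
  have hM' := hM.toIsContactMetric.toIsAlmostContactMetric
  set T := tangentSub (E := E) S x with hT
  have heT : ∀ i, e i x ∈ T := fun i ↦ (heS i).self_of_nhdsWithin hx
  have hon' : Orthonormal ℝ (fun i ↦ (⟨e i x, heT i⟩ : T)) := by
    refine ⟨fun i ↦ hon.1 i, fun i j hij ↦ hon.2 hij⟩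
  have hcard : Fintype.card (Fin d) = Module.finrank ℝ T := by
    rw [hS.finrank_tangentSub hx, Fintype.card_fin]
  let b : OrthonormalBasis (Fin d) ℝ T := OrthonormalBasis.mk hon'
    (hon'.linearIndependent.span_eq_top_of_card_eq_finrank' hcard).ge
  have hb : ∀ i, (b i : TangentSpace 𝓘(ℝ, E) x) = e i x := fun i ↦ by simp [b]
  have hrep : ∀ v ∈ T, v = ∑ k, ⟪e k x, v⟫_ℝ • e k x := fun v hv ↦ by
    have := congrArg (Subtype.val) (b.sum_repr' ⟨v, hv⟩)
    simp only [AddSubmonoidClass.coe_finsetSum, Submodule.coe_smul, hb, Submodule.coe_inner] at this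
    exact this.symm
  set w : Fin d → Fin d → TangentSpace 𝓘(ℝ, E) x := fun i j ↦ nabla (e i x) (e j) with hw
  -- Classes modulo `T` are separated by differentials of functions vanishing on `S`, by the
  -- definition of `tangentSub`.
  have hsep : ∀ a a' : TangentSpace 𝓘(ℝ, E) x, (∀ f : M → ℝ, ContMDiffAt 𝓘(ℝ, E) 𝓘(ℝ, ℝ) ∞ f x →
      (∀ᶠ y in 𝓝[S] x, f y = 0) → mvfderiv 𝓘(ℝ, E) f x a = mvfderiv 𝓘(ℝ, E) f x a') →
      T.mkQ a = T.mkQ a' := fun a a' h ↦ by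
    refine (Submodule.Quotient.eq T).2 ?_
    simp only [hT, tangentSub, Submodule.mem_iInf]
    rintro ⟨f, hf, hf0⟩
    refine LinearMap.mem_ker.2 ((map_sub (mvfderiv 𝓘(ℝ, E) f x) _ _).trans ?_)
    rw [h f hf hf0, sub_self]
  -- On such differentials the second fundamental form is minus the Hessian, hence symmetric and
  -- dependent only on the values of the fields at `x`.
  have hd1 : ∀ i j (f : M → ℝ) (hf : ContMDiffAt 𝓘(ℝ, E) 𝓘(ℝ, ℝ) ∞ f x),
      (∀ᶠ y in 𝓝[S] x, f y = 0) →
      mvfderiv 𝓘(ℝ, E) f x (w i j) = -hessian hf (e i x) (e j x) := fun i j f hf hf0 ↦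
    eq_neg_of_add_eq_zero_right (hS.hessian_add_eq_zero hx hf hf0 (heT i) (he j) (heS j))
  have hW1 : ∀ i j, T.mkQ (w i j) = T.mkQ (w j i) := fun i j ↦ hsep _ _ fun f hf hf0 ↦ by
    rw [hd1 i j f hf hf0, hd1 j i f hf hf0, hessian_comm]
  -- The term `(∇_{e_i} φ) e_j` lies in the span of `ξ` and `e_i`, so it is tangent and disappears
  -- modulo `T`.
  have hW2 : ∀ i j, T.mkQ (φ x (w i j)) = T.mkQ (∑ k, ⟪e k x, φ x (e j x)⟫_ℝ • w i k) :=
    fun i j ↦ hsep _ _ fun f hf hf0 ↦ by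
      have h1 := hS.hessian_add_eq_zero hx hf hf0 (heT i) (hM.smooth_phi.app (he j)) (by
        filter_upwards [heS j, self_mem_nhdsWithin] with y h1 h2 using hφ y h2 _ h1)
      have h2 : mvfderiv 𝓘(ℝ, E) f x (covEnd φ (e i x) (e j x)) = 0 := by
        refine hS.mvfderiv_eq_zero hx (hf.of_le (by simp)) hf0 ?_
        rw [hM.covEnd_phi]
        exact sub_mem (T.smul_mem _ (hξ x hx)) (T.smul_mem _ (heT i))
      rw [nabla_app hM.smooth_phi (he j), map_add, h2, zero_add] at h1
      have h3 : mvfderiv 𝓘(ℝ, E) f x (φ x (w i j)) = -hessian hf (e i x) (φ x (e j x)) :=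
        eq_neg_of_add_eq_zero_right h1
      rw [h3]
      conv_lhs => rw [hrep _ (hφ x hx _ (heT j))]
      simp only [map_sum, map_smul, hd1 i _ f hf hf0, smul_neg, Finset.sum_neg_distrib]
  -- The second fundamental form, with the normal space modelled by the quotient; there `φ` induces
  -- `J` with `J² = -1` because `ξ` is tangent.
  let B : T →ₗ[ℝ] T →ₗ[ℝ] (TangentSpace 𝓘(ℝ, E) x ⧸ T) :=
    b.toBasis.constr ℝ fun i ↦ b.toBasis.constr ℝ fun j ↦ T.mkQ (w i j)
  have hBb : ∀ i j, B (b i) (b j) = T.mkQ (w i j) := fun i j ↦ by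
    simp only [B, ← b.coe_toBasis, Module.Basis.constr_basis]
  let φT : T →ₗ[ℝ] T := (φ x).toLinearMap.restrict (hφ x hx)
  let J : (TangentSpace 𝓘(ℝ, E) x ⧸ T) →ₗ[ℝ] (TangentSpace 𝓘(ℝ, E) x ⧸ T) :=
    T.mapQ T (φ x).toLinearMap (hφ x hx)
  have hsum := trace_eq_zero b φT ⟨ξ x, hξ x hx⟩ J 0 B ?_ ?_ ?_ ?_ ?_ ?_ ?_ ?_
  · simp only [hBb, ← map_sum] at hsum
    have h1 : ∑ i, w i i ∈ T := (Submodule.Quotient.mk_eq_zero T).1 hsum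
    refine (Submodule.starProjection_apply_eq_zero_iff _).2 ?_
    rwa [Submodule.orthogonal_orthogonal]
  · intro q
    obtain ⟨v, rfl⟩ := T.mkQ_surjective q
    have h1 : J (J (T.mkQ v)) = T.mkQ (φ x (φ x v)) := rfl
    rw [h1, hM.phi_phi, map_add, map_smul]
    have h2 : T.mkQ (ξ x) = 0 := (Submodule.Quotient.mk_eq_zero T).2 (hξ x hx)
    rw [h2, smul_zero, add_zero, map_neg]
  · have h1 : B = B.flip := b.toBasis.ext fun i ↦ b.toBasis.ext fun j ↦ by
      simp only [b.coe_toBasis, LinearMap.flip_apply, hBb, hW1 i j]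
    intro u v
    exact congrArg (fun A ↦ A u v) h1
  · have h1 : B.compl₂ φT = B.compr₂ J := b.toBasis.ext fun i ↦ b.toBasis.ext fun j ↦ by
      simp only [b.coe_toBasis, LinearMap.compl₂_apply, LinearMap.compr₂_apply, hBb]
      have h2 : J (T.mkQ (w i j)) = T.mkQ (φ x (w i j)) := rfl
      rw [h2, hW2, ← b.sum_repr' (φT (b j))]
      simp only [map_sum, map_smul, hBb, Submodule.coe_inner, hb]
      have h3 : (φT (b j) : TangentSpace 𝓘(ℝ, E) x) = φ x (e j x) := congrArg (φ x) (hb j)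
      rw [h3]
    intro u v
    rw [LinearMap.zero_apply, smul_zero, add_zero]
    exact congrArg (fun A ↦ A u v) h1
  · simp
  · simp
  · exact Subtype.ext (hM'.phi_xi x)
  · exact fun u v ↦ hM'.inner_phi x u v
  · intro u v
    simp only [Submodule.coe_inner, ← hM'.eta_eq]
    exact hM'.compatible x u v

end Minimal

/-! ### Preimages of complex submanifolds -/

section Fibers

variable {E : Type*} [NormedAddCommGroup E] [NormedSpace ℝ E] [FiniteDimensional ℝ E]
  {M : Type*} [TopologicalSpace M] [ChartedSpace E M] [IsManifold 𝓘(ℝ, E) ∞ M]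
  {F : Type*} [NormedAddCommGroup F] [NormedSpace ℝ F] [FiniteDimensional ℝ F]
  {N : Type*} [TopologicalSpace N] [ChartedSpace F N] [IsManifold 𝓘(ℝ, F) ∞ N]
  [RiemannianBundle (fun x : M ↦ TangentSpace 𝓘(ℝ, E) x)]
  [RiemannianBundle (fun y : N ↦ TangentSpace 𝓘(ℝ, F) y)]
  {φ : EndField E M} {ξ : VF E M} {η : OneForm E M} {J : EndField F N} {ψ : M → N}

lemma isComplexSubmanifold_singleton (J : EndField F N) (y : N) :
    IsComplexSubmanifold J {y} 0 := by
  refine ⟨isSubmanifold_singleton y, fun z hz v hv ↦ ?_⟩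
  obtain rfl : z = y := hz
  rw [tangentSub_singleton, Submodule.mem_bot] at hv
  rw [hv, map_zero]
  exact zero_mem _

namespace IsHolomorphicSubmersion

lemma isInvariantSub_preimage (h : IsHolomorphicSubmersion φ J ψ) {K : Set N} {k : ℕ}
    (hK : IsComplexSubmanifold J K k) : IsInvariantSub φ (ψ ⁻¹' K) := fun x hx v hv ↦ by
  rw [hK.1.mem_tangentSub_preimage h.smooth h.submersion hx] at hv ⊢
  rw [h.holomorphic]
  exact hK.2 _ hx _ hv

lemma isMinimalSubmanifold_preimage
    [IsContMDiffRiemannianBundle 𝓘(ℝ, E) ∞ E (fun x : M ↦ TangentSpace 𝓘(ℝ, E) x)] {m : ℕ}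
    (h : IsHolomorphicSubmersion φ J ψ) (hM : IsSasaki m φ ξ η)
    (hN : IsKaehler J) {K : Set N} {k d : ℕ} (hK : IsComplexSubmanifold J K k)
    (hd : d + Module.finrank ℝ F = 2 * k + Module.finrank ℝ E) :
    IsMinimalSubmanifold (E := E) (ψ ⁻¹' K) d := by
  refine hM.isMinimalSubmanifold (hK.1.preimage h.smooth h.submersion hd)
    (h.isInvariantSub_preimage hK) fun x hx ↦ ?_
  rw [hK.1.mem_tangentSub_preimage h.smooth h.submersion hx,
    h.mfderiv_xi hM.toIsContactMetric.toIsAlmostContactMetric hN]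
  exact zero_mem _

end IsHolomorphicSubmersion

end Fibers

/-! ### The case of one-dimensional fibers -/

section EqualDimension

variable {E : Type*} [NormedAddCommGroup E] [NormedSpace ℝ E] [FiniteDimensional ℝ E]
  {M : Type*} [TopologicalSpace M] [ChartedSpace E M] [IsManifold 𝓘(ℝ, E) ∞ M]
  {F : Type*} [NormedAddCommGroup F] [NormedSpace ℝ F] [FiniteDimensional ℝ F]
  {N : Type*} [TopologicalSpace N] [ChartedSpace F N] [IsManifold 𝓘(ℝ, F) ∞ N]
  [RiemannianBundle (fun x : M ↦ TangentSpace 𝓘(ℝ, E) x)]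
  [RiemannianBundle (fun y : N ↦ TangentSpace 𝓘(ℝ, F) y)]
  {φ : EndField E M} {ξ : VF E M} {η : OneForm E M} {J : EndField F N} {ψ : M → N}

lemma IsAlmostContactMetric.kerForm_eq (hM : IsAlmostContactMetric φ ξ η) (x : M) :
    kerForm η x = (ℝ ∙ ξ x)ᗮ := by
  ext v
  rw [Submodule.mem_orthogonal_singleton_iff_inner_right, ← hM.eta_eq]
  exact LinearMap.mem_ker

namespace IsHolomorphicSubmersion

lemma finrank_le (h : IsHolomorphicSubmersion φ J ψ) (x : M) :
    Module.finrank ℝ F ≤ Module.finrank ℝ E :=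
  LinearMap.finrank_le_finrank_of_surjective
    (f := (mfderiv 𝓘(ℝ, E) 𝓘(ℝ, F) ψ x).toLinearMap) (h.submersion x)

/-- The vertical space is a line containing `ξ ≠ 0`, so its orthogonal complement is that of `ξ`,
which is `ker η`. -/
lemma horizontal_eq_kerForm (h : IsHolomorphicSubmersion φ J ψ)
    (hM : IsAlmostContactMetric φ ξ η) (hN : IsKaehler J)
    (hd : Module.finrank ℝ E = Module.finrank ℝ F + 1) (x : M) :
    horizontal E F ψ x = kerForm η x := by
  have h0 : ξ x ≠ 0 := fun h0 ↦ by
    have := hM.eta_xi x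
    rw [h0, map_zero] at this
    exact zero_ne_one this
  have h1 : Module.finrank ℝ (vertical E F ψ x) = 1 := by
    have h2 := LinearMap.finrank_range_add_finrank_ker
      (mfderiv 𝓘(ℝ, E) 𝓘(ℝ, F) ψ x).toLinearMap
    have h3 : LinearMap.range (mfderiv 𝓘(ℝ, E) 𝓘(ℝ, F) ψ x).toLinearMap = ⊤ :=
      LinearMap.range_eq_top.2 (h.submersion x)
    have h4 : Module.finrank ℝ (TangentSpace 𝓘(ℝ, E) x) = Module.finrank ℝ E := rfl
    have h5 : Module.finrank ℝ (TangentSpace 𝓘(ℝ, F) (ψ x)) = Module.finrank ℝ F := rfl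
    rw [h3, finrank_top, h4, h5] at h2
    have h6 : Module.finrank ℝ (vertical E F ψ x) = Module.finrank ℝ
      (LinearMap.ker (mfderiv 𝓘(ℝ, E) 𝓘(ℝ, F) ψ x).toLinearMap) := rfl
    omega
  have h2 : (ℝ ∙ ξ x) = vertical E F ψ x := Submodule.eq_of_le_of_finrank_eq
    ((Submodule.span_singleton_le_iff_mem _ _).2 (h.xi_mem_vertical hM hN x))
    (by rw [finrank_span_singleton h0, h1])
  rw [hM.kerForm_eq, h2, horizontal]

end IsHolomorphicSubmersion

variable [IsContMDiffRiemannianBundle 𝓘(ℝ, E) ∞ E (fun x : M ↦ TangentSpace 𝓘(ℝ, E) x)]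

/-- The contact distribution is not integrable. -/
lemma IsContactMetric.not_isIntegrable {m : ℕ} (hM : IsContactMetric m φ ξ η) [Nonempty M]
    (hd : 2 ≤ Module.finrank ℝ E) : ¬ IsIntegrable (kerForm η) := by
  intro hint
  have hM' := hM.toIsAlmostContactMetric
  obtain ⟨x⟩ := ‹Nonempty M›
  obtain ⟨v, hv, hv0⟩ : ∃ v ∈ kerForm η x, v ≠ 0 := by
    refine Submodule.exists_mem_ne_zero_of_ne_bot fun hbot ↦ ?_
    have h1 := LinearMap.finrank_range_add_finrank_ker (η x).toLinearMap
    have h2 : Module.finrank ℝ (LinearMap.ker (η x).toLinearMap) = 0 := by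
      have : LinearMap.ker (η x).toLinearMap = ⊥ := hbot
      rw [this, finrank_bot]
    have h3 := Submodule.finrank_le (LinearMap.range (η x).toLinearMap)
    have h4 : Module.finrank ℝ (TangentSpace 𝓘(ℝ, E) x) = Module.finrank ℝ E := rfl
    rw [Module.finrank_self] at h3
    omega
  have hv' : η x v = 0 := hv
  -- Removing the `ξ`-component of the extension keeps the field in `ker η` everywhere, without
  -- changing its value `v` at `x`.
  set X : VF E M := fun y ↦ ext v y - η y (ext v y) • ξ y with hX
  have hsm : ContMDiffAt 𝓘(ℝ, E) 𝓘(ℝ, ℝ) ∞ (fun y ↦ η y (ext v y)) x := by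
    simp only [hM'.eta_eq]
    exact smooth_inner (hM.smooth_xi x) (smooth_ext v)
  have hXs : SmoothVFAt X x :=
    ContMDiffAt.sub_section (smooth_ext v) (hsm.smul_section (hM.smooth_xi x))
  have hXx : X x = v := by simp [hX, hv']
  have hXη : ∀ y, η y (X y) = 0 := fun y ↦ by
    simp [hX, map_sub, map_smul, hM.eta_xi]
  have hYη : ∀ y, η y (φ y (X y)) = 0 := fun y ↦ hM'.eta_phi y _
  have hYs := hM.smooth_phi.app hXs
  -- The right-hand side is `g(v, φ² v) = -|v|²`, while every term of `dη(X, φX)` vanishes if the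
  -- bracket stays in `ker η`.
  have h1 := hM.associated x X (app φ X) hXs hYs
  have h2 : η x (mlieBracket 𝓘(ℝ, E) X (app φ X) x) = 0 :=
    hint x X (app φ X) hXs hYs (Eventually.of_forall hXη) (Eventually.of_forall hYη)
  simp only [extDer, hXη, hYη, mvfderiv_const, zero_apply, h2, app, hXx, hM.phi_phi, hv', zero_smul,
    add_zero, inner_neg_right] at h1
  have h3 : ⟪v, v⟫_ℝ = 0 := by linarith
  exact hv0 (inner_self_eq_zero.1 h3)

end EqualDimension

end SasakiPHH

end

theorem proposition5p3 {m n : ℕ}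
    {M : Type*} [TopologicalSpace M] [T2Space M] [SecondCountableTopology M] [ConnectedSpace M]
    [ChartedSpace (EuclideanSpace ℝ (Fin (2 * m + 1))) M]
    [IsManifold 𝓘(ℝ, EuclideanSpace ℝ (Fin (2 * m + 1))) ∞ M]
    [RiemannianBundle
      (fun x : M ↦ TangentSpace 𝓘(ℝ, EuclideanSpace ℝ (Fin (2 * m + 1))) x)]
    [IsContMDiffRiemannianBundle 𝓘(ℝ, EuclideanSpace ℝ (Fin (2 * m + 1))) ∞
      (EuclideanSpace ℝ (Fin (2 * m + 1)))
      (fun x : M ↦ TangentSpace 𝓘(ℝ, EuclideanSpace ℝ (Fin (2 * m + 1))) x)]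
    {N : Type*} [TopologicalSpace N] [T2Space N] [SecondCountableTopology N] [ConnectedSpace N]
    [ChartedSpace (EuclideanSpace ℝ (Fin (2 * n))) N]
    [IsManifold 𝓘(ℝ, EuclideanSpace ℝ (Fin (2 * n))) ∞ N]
    [RiemannianBundle
      (fun y : N ↦ TangentSpace 𝓘(ℝ, EuclideanSpace ℝ (Fin (2 * n))) y)]
    [IsContMDiffRiemannianBundle 𝓘(ℝ, EuclideanSpace ℝ (Fin (2 * n))) ∞
      (EuclideanSpace ℝ (Fin (2 * n)))
      (fun y : N ↦ TangentSpace 𝓘(ℝ, EuclideanSpace ℝ (Fin (2 * n))) y)]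
    (φ : SasakiPHH.EndField (EuclideanSpace ℝ (Fin (2 * m + 1))) M)
    (ξ : SasakiPHH.VF (EuclideanSpace ℝ (Fin (2 * m + 1))) M)
    (η : SasakiPHH.OneForm (EuclideanSpace ℝ (Fin (2 * m + 1))) M)
    (hM : SasakiPHH.IsSasaki m φ ξ η)
    (J : SasakiPHH.EndField (EuclideanSpace ℝ (Fin (2 * n))) N)
    (hN : SasakiPHH.IsKaehler J)
    (ψ : M → N) (hψ : SasakiPHH.IsHolomorphicSubmersion φ J ψ)
    (hsurj : Function.Surjective ψ) :
    SasakiPHH.IsPseudoHarmonicMorphism (E := EuclideanSpace ℝ (Fin (2 * m + 1))) J ψ ∧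
    SasakiPHH.IsPHH (E := EuclideanSpace ℝ (Fin (2 * m + 1))) J ψ ∧
    (∀ y : N, SasakiPHH.IsMinimalSubmanifold (E := EuclideanSpace ℝ (Fin (2 * m + 1)))
      (ψ ⁻¹' {y}) (2 * m + 1 - 2 * n)) ∧
    (∀ (K : Set N) (k : ℕ), SasakiPHH.IsComplexSubmanifold J K k →
      SasakiPHH.IsInvariantSub φ (ψ ⁻¹' K) ∧
      SasakiPHH.IsMinimalSubmanifold (E := EuclideanSpace ℝ (Fin (2 * m + 1)))
        (ψ ⁻¹' K) (2 * k + (2 * m + 1 - 2 * n))) ∧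
    (m = n →
      (∀ x : M, SasakiPHH.horizontal (EuclideanSpace ℝ (Fin (2 * m + 1)))
        (EuclideanSpace ℝ (Fin (2 * n))) ψ x = SasakiPHH.kerForm η x) ∧
      (1 ≤ m → ¬ SasakiPHH.IsIntegrable (SasakiPHH.horizontal
        (EuclideanSpace ℝ (Fin (2 * m + 1))) (EuclideanSpace ℝ (Fin (2 * n))) ψ))) := by
  have hM' := hM.toIsContactMetric.toIsAlmostContactMetric
  have hE : Module.finrank ℝ (EuclideanSpace ℝ (Fin (2 * m + 1))) = 2 * m + 1 :=
    finrank_euclideanSpace_fin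
  have hF : Module.finrank ℝ (EuclideanSpace ℝ (Fin (2 * n))) = 2 * n :=
    finrank_euclideanSpace_fin
  -- Ensures that the truncated subtraction `2 * m + 1 - 2 * n` is the true fiber dimension.
  have hmn : 2 * n ≤ 2 * m + 1 := by
    have := hψ.finrank_le (Classical.arbitrary M)
    rwa [hE, hF] at this
  have hpre : ∀ (K : Set N) (k : ℕ), SasakiPHH.IsComplexSubmanifold J K k →
      SasakiPHH.IsMinimalSubmanifold (E := EuclideanSpace ℝ (Fin (2 * m + 1)))
        (ψ ⁻¹' K) (2 * k + (2 * m + 1 - 2 * n)) := fun K k hK ↦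
    hψ.isMinimalSubmanifold_preimage hM hN hK (by rw [hE, hF]; omega)
  refine ⟨⟨hψ.isHarmonicMap hM hN, hψ.isPHWC hM' hN⟩, hψ.isPHH hM hN, fun y ↦ ?_,
    fun K k hK ↦ ⟨hψ.isInvariantSub_preimage hK, hpre K k hK⟩, fun hmn' ↦ ?_⟩
  · simpa using hpre {y} 0 (SasakiPHH.isComplexSubmanifold_singleton J y)
  · have hH := hψ.horizontal_eq_kerForm hM' hN (by rw [hE, hF, hmn'])
    refine ⟨hH, fun hm ↦ ?_⟩
    rw [funext hH]
    exact hM.toIsContactMetric.not_isIntegrable (by rw [hE]; omega)
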